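/- Let $n\ge 1$ be an integer and let $s\in\mathbb R$ satisfy $s-\frac n2\in(0,1)\cup(1,2)$. Let $P_\ell$ be the orthogonal projection of the real space $L^2(\mathbb S^n)$ (with the non-normalized surface measure) onto the spherical harmonics of degree $\ell\ge 0$, let $$\alpha_{2s}(\ell)=\frac{\Gamma(\ell+\frac n2+s)}{\Gamma(\ell+\frac n2-s)},\qquad H^s(\mathbb S^n)=\Big\{u\in L^2(\mathbb S^n):\ \sum_{\ell\ge0}(1+\ell)^{2s}\|P_\ell u\|_2^2<\infty\Big\},$$ and for $u,v\in H^s(\mathbb S^n)$ let $$a_{2s}[u,v]=\sum_{\ell\ge0}\alpha_{2s}(\ell)\,(P_\ell u,P_\ell v)_{L^2},\qquad a_{2s}[u]=a_{2s}[u,u].$$ Let $$\mathcal M=\Big\{\omega\mapsto c\,(1-\zeta\cdot\omega)^{\frac{2s-n}2}:\ c>0,\ \zeta\in\mathbb R^{n+1},\ |\zeta|<1\Big\}.$$ For $h\in\mathcal M$ let $T_h\mathcal M$ be the tangent space of $\mathcal M$ at $h$, that is, the set of all continuous functions $\eta$ on $\mathbb S^n$ with $\eta(\omega)=\frac{d}{dt}\big|_{t=0}\gamma_t(\omega)$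 for all $\omega\in\mathbb S^n$, for some path $t\mapsto\gamma_t$ that lies in $\mathcal M$ for $t$ near $0$ and has $\gamma_0=h$. Let $$(T_h\mathcal M)^\perp=\{\rho\in H^s(\mathbb S^n):\ a_{2s}[\rho,\varphi]=0\ \text{ for all }\varphi\in T_h\mathcal M\}.$$ For $u\in H^s(\mathbb S^n)$ write $u>0$ if the continuous representative of $u$ is positive at every point of $\mathbb S^n$, and for such $u$ let $$\mathsf d(u)=\inf\big\{a_{2s}[\rho]:\ u=h+\rho\ \text{ with } h\in\mathcal M,\ \rho\in(T_h\mathcal M)^\perp\big\}.$$ Then the following hold. 1. For every $h\in\mathcal M$, $a_{2s}$ is positive definite on $(T_h\mathcal M)^\perp$: $a_{2s}[\rho]>0$ for every $0\ne\rho\in(T_h\mathcal M)^\perp$. 2. For every $u\in H^s(\mathbb S^n)$ with $u>0$ there are $h\in\mathcal M$ and $\rho\in(T_h\mathcal M)^\perp$ such that $u=h+\rho$. 3. For every $u\in H^s(\mathbb S^n)$ with $u>0$, the set in the definition of $\mathsf d(u)$ is nonempty and bounded below, so that $\mathsf d(u)$ is a well-defined real number; and $\mathsf d(u)>0$ if $u\notin\mathcal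 M$. -/

import Mathlib

open MeasureTheory Topology

noncomputable section

namespace ReverseSobolev

/-- The unit sphere `𝕊ⁿ ⊂ ℝⁿ⁺¹`. -/
abbrev Sph (n : ℕ) : Type := Metric.sphere (0 : EuclideanSpace ℝ (Fin (n + 1))) 1

/-- The (non-normalized) surface measure on `𝕊ⁿ`. -/
abbrev surf (n : ℕ) : Measure (Sph n) :=
  (volume : Measure (EuclideanSpace ℝ (Fin (n + 1)))).toSphere

/-- The real Hilbert space `L²(𝕊ⁿ)`. -/
abbrev L2 (n : ℕ) : Type := Lp ℝ 2 (surf n)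

/-- The class in `L²(𝕊ⁿ)` of a continuous function. -/
def toL2 (n : ℕ) : C(Sph n, ℝ) →L[ℝ] L2 n := ContinuousMap.toLp 2 (surf n) ℝ

/-- Restriction of a polynomial in `n + 1` variables to the sphere. -/
def restrictPoly (n : ℕ) : MvPolynomial (Fin (n + 1)) ℝ →ₗ[ℝ] C(Sph n, ℝ) where
  toFun p := ⟨fun ω => MvPolynomial.eval (fun i => (ω : EuclideanSpace ℝ (Fin (n + 1))) i) p, by
    refine (MvPolynomial.continuous_eval p).comp (continuous_pi fun i => ?_)
    fun_prop⟩
  map_add' p q := by ext ω; simp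
  map_smul' c p := by ext ω; simp

/-- The Laplacian `∑ᵢ ∂ᵢ²` on polynomials. -/
def polyLaplacian (n : ℕ) : MvPolynomial (Fin (n + 1)) ℝ →ₗ[ℝ] MvPolynomial (Fin (n + 1)) ℝ :=
  ∑ i, (MvPolynomial.pderiv i).toLinearMap ∘ₗ (MvPolynomial.pderiv i).toLinearMap

/-- The spherical harmonics of degree `ℓ`: restrictions to `𝕊ⁿ` of the harmonic homogeneous
polynomials of degree `ℓ`, as a subspace of `L²(𝕊ⁿ)`. -/
def sphericalHarmonics (n ℓ : ℕ) : Submodule ℝ (L2 n) :=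
  (MvPolynomial.homogeneousSubmodule (Fin (n + 1)) ℝ ℓ ⊓ LinearMap.ker (polyLaplacian n)).map
    ((toL2 n).toLinearMap ∘ₗ restrictPoly n)

instance sphericalHarmonics_finiteDimensional (n ℓ : ℕ) :
    FiniteDimensional ℝ (sphericalHarmonics n ℓ) := by
  have : FiniteDimensional ℝ (MvPolynomial.homogeneousSubmodule (Fin (n + 1)) ℝ ℓ) :=
    Module.Finite.iff_fg.mpr (MvPolynomial.homogeneousSubmodule_fg _ _ ℓ)
  have : FiniteDimensional ℝ ↥(MvPolynomial.homogeneousSubmodule (Fin (n + 1)) ℝ ℓ ⊓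
      LinearMap.ker (polyLaplacian n)) :=
    Submodule.finiteDimensional_inf_left _ _
  unfold sphericalHarmonics
  infer_instance

/-- The `L²`-orthogonal projection `P_ℓ` onto the spherical harmonics of degree `ℓ`. -/
def P (n ℓ : ℕ) : L2 n →L[ℝ] L2 n := (sphericalHarmonics n ℓ).starProjection

/-- The eigenvalue `α_{2s}(ℓ) = Γ(ℓ + n/2 + s) / Γ(ℓ + n/2 - s)`. As `Real.Gamma` vanishes at its
poles and `x / 0 = 0`, this is `0` when `ℓ + n/2 - s` is a nonpositive integer. -/
def α (n : ℕ) (s : ℝ) (ℓ : ℕ) : ℝ :=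
  Real.Gamma (ℓ + n / 2 + s) / Real.Gamma (ℓ + n / 2 - s)

/-- The Sobolev space `H^s(𝕊ⁿ)`, as a set of elements of `L²(𝕊ⁿ)`. -/
def Hs (n : ℕ) (s : ℝ) : Set (L2 n) :=
  {u | Summable fun ℓ : ℕ => (1 + (ℓ : ℝ)) ^ (2 * s) * ‖P n ℓ u‖ ^ 2}

/-- The bilinear form `a_{2s}[u, v] = ∑_ℓ α_{2s}(ℓ) (P_ℓ u, P_ℓ v)`; the series converges
absolutely for `u, v ∈ H^s(𝕊ⁿ)`. -/
def aBilin (n : ℕ) (s : ℝ) (u v : L2 n) : ℝ :=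
  ∑' ℓ : ℕ, α n s ℓ * inner ℝ (P n ℓ u) (P n ℓ v)

/-- The quadratic form `a_{2s}[u] = ∑_ℓ α_{2s}(ℓ) ‖P_ℓ u‖²`. -/
def aQuad (n : ℕ) (s : ℝ) (u : L2 n) : ℝ :=
  ∑' ℓ : ℕ, α n s ℓ * ‖P n ℓ u‖ ^ 2

/-- `u > 0`: the continuous representative of `u` is positive at every point of the sphere.
(For `s > n/2` every element of `H^s(𝕊ⁿ)` has a unique continuous representative.) -/
def IsPos {n : ℕ} (u : L2 n) : Prop :=
  ∃ f : C(Sph n, ℝ), toL2 n f = u ∧ ∀ ω, 0 < f ω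

/-- The manifold `𝓜` of the functions `ω ↦ c (1 - ζ·ω)^((2s-n)/2)` with `c > 0`, `|ζ| < 1`. -/
def optimizers (n : ℕ) (s : ℝ) : Set C(Sph n, ℝ) :=
  {h | ∃ c : ℝ, 0 < c ∧ ∃ ζ : EuclideanSpace ℝ (Fin (n + 1)), ‖ζ‖ < 1 ∧
    ∀ ω : Sph n, h ω =
      c * (1 - inner ℝ ζ (ω : EuclideanSpace ℝ (Fin (n + 1)))) ^ ((2 * s - n) / 2)}

/-- The tangent space `T_h 𝓜`: velocities at time `0` of paths in `𝓜` through `h`. -/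
def tangentSpace (n : ℕ) (s : ℝ) (h : C(Sph n, ℝ)) : Set C(Sph n, ℝ) :=
  {η | ∃ γ : ℝ → C(Sph n, ℝ), (∀ᶠ t in 𝓝 0, γ t ∈ optimizers n s) ∧ γ 0 = h ∧
    ∀ ω, HasDerivAt (fun t => γ t ω) (η ω) 0}

/-- `(T_h 𝓜)^⊥`, the orthogonal complement in `H^s(𝕊ⁿ)` with respect to `a_{2s}`. -/
def tangentPerp (n : ℕ) (s : ℝ) (h : C(Sph n, ℝ)) : Set (L2 n) :=
  {ρ | ρ ∈ Hs n s ∧ ∀ φ ∈ tangentSpace n s h, aBilin n s ρ (toL2 n φ) = 0}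

/-- The values `a_{2s}[ρ]` over all decompositions `u = h + ρ`, `h ∈ 𝓜`, `ρ ∈ (T_h 𝓜)^⊥`. -/
def distValues (n : ℕ) (s : ℝ) (u : L2 n) : Set ℝ :=
  {t | ∃ h ∈ optimizers n s, ∃ ρ ∈ tangentPerp n s h, u = toL2 n h + ρ ∧ t = aQuad n s ρ}

/-- The modified distance `𝖽(u)` to `𝓜`. -/
def dist (n : ℕ) (s : ℝ) (u : L2 n) : ℝ := sInf (distValues n s u)

end ReverseSobolev

end

noncomputable section

namespace ReverseSobolev

/-! Write β = s - n/2, and let A be the operator with eigenvalue α_{2s}(ℓ) on the harmonics of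
degree ℓ. The key fact is that A maps (1 - ζ·ω)^β to α_{2s}(0) (1 - |ζ|²)^s (1 - ζ·ω)^(-n-β)
(`isImage_kern`). No conformal maps are used. Tested against a harmonic of degree ℓ, both powers
become power series in |ζ|; Euler's hypergeometric transformation makes them solutions of one
second-order equation, hence proportional (`integral_harmonic_kernel`), and the recurrence of the
eigenvalues matches the constants. Differentiation in ζ gives A on the other tangent vectors
(`isImage_lin_mul_kern`), so that a_{2s}-orthogonality to T_h 𝓜 becomes a set of explicit L²
conditions (`mem_tangentPerp_iff`).

Positivity is a count of dimensions. Only α_{2s}(0) is negative if β < 1, and only α_{2s}(1) if 1 <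
β < 2, so the form is negative in 1 or n + 1 dimensions. The tangent space contains a negative
definite subspace of that dimension: the line through h, respectively the tangent vectors
a_{2s}-orthogonal to h. Nothing negative is left for its complement (`aQuad_pos_of_orthogonal`).

For existence, let f > 0 and G(ζ) = (1 - |ζ|²)^((n+β)/2) ∫ f (1 - ζ·ω)^(-n-β), which is
`confMoment`. The decompositions f = h + ρ correspond exactly to the critical points of G, and c is
determined by ζ (`sub_mem_tangentPerp_iff`). As f is bounded below by a positive constant, G blows
up at the boundary of the ball (`exists_radius`), so it has a minimum.

A decomposition has a_{2s}[ρ] = a_{2s}[f] - α_{2s}(0) G(ζ)²/|𝕊ⁿ|. If α_{2s}(0) < 0, the minimum of G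
gives the least value. If α_{2s}(0) > 0, positivity of a_{2s}[ρ] bounds G on its critical set, which
is therefore compact, and a least value exists again (`exists_isLeast_distValues`). An attained
infimum is a_{2s}[ρ] for an actual ρ, which is nonzero when f is not in 𝓜. -/

/-! ### Polar coordinates and a radial cutoff -/

/-- The Euclidean space `ℝⁿ⁺¹`. -/
abbrev Eu (n : ℕ) : Type := EuclideanSpace ℝ (Fin (n + 1))

/-- Evaluation of a polynomial at a point of Euclidean space. -/
def evalE (n : ℕ) (p : MvPolynomial (Fin (n + 1)) ℝ) (x : Eu n) : ℝ :=
  MvPolynomial.eval (fun i => x i) p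

lemma restrictPoly_apply (n : ℕ) (p : MvPolynomial (Fin (n + 1)) ℝ) (ω : Sph n) :
    restrictPoly n p ω = evalE n p ω := rfl

lemma continuous_evalE (n : ℕ) (p : MvPolynomial (Fin (n + 1)) ℝ) : Continuous (evalE n p) := by
  refine (MvPolynomial.continuous_eval p).comp (continuous_pi fun i => ?_)
  fun_prop

lemma evalE_smul {n q : ℕ} {p : MvPolynomial (Fin (n + 1)) ℝ} (hp : p.IsHomogeneous q) (r : ℝ)
    (x : Eu n) : evalE n p (r • x) = r ^ q * evalE n p x := by
  simp only [evalE, MvPolynomial.eval_eq, Finset.mul_sum]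
  refine Finset.sum_congr rfl fun d hd => ?_
  have hdeg : ∑ i ∈ d.support, d i = q := by
    have := hp (MvPolynomial.mem_support_iff.1 hd)
    rw [Finsupp.weight_apply, Finsupp.sum] at this
    simpa using this
  simp only [PiLp.smul_apply, smul_eq_mul, mul_pow, Finset.prod_mul_distrib]
  rw [Finset.prod_pow_eq_pow_sum, hdeg]
  ring

lemma hasLineDerivAt_evalE (n : ℕ) (p : MvPolynomial (Fin (n + 1)) ℝ)
    (i : Fin (n + 1)) (x : Eu n) :
    HasLineDerivAt ℝ (evalE n p) (evalE n (MvPolynomial.pderiv i p) x) x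
      (EuclideanSpace.single i 1) := by
  unfold HasLineDerivAt
  induction p using MvPolynomial.induction_on with
  | C a => simpa [evalE] using hasDerivAt_const (0 : ℝ) a
  | add p q hp hq => simp only [evalE, map_add] at hp hq ⊢; exact hp.add hq
  | mul_X p j hp =>
    have hX : HasDerivAt (fun t : ℝ => (x + t • EuclideanSpace.single i (1 : ℝ)) j)
        (if j = i then 1 else 0) 0 := by
      have : (fun t : ℝ => (x + t • EuclideanSpace.single i (1 : ℝ)) j) =
          fun t => x j + t * (if j = i then 1 else 0) := by
        ext t; simp
      rw [this]
      simpa using ((hasDerivAt_id (0 : ℝ)).mul_const (if j = i then (1 : ℝ) else 0)).const_add (x j)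
    have h := hp.mul hX
    have e : (evalE n (MvPolynomial.pderiv i (p * MvPolynomial.X j)) x) =
      evalE n (MvPolynomial.pderiv i p) x * (x + (0 : ℝ) • EuclideanSpace.single i (1 : ℝ)) j +
      evalE n p (x + (0 : ℝ) • EuclideanSpace.single i (1 : ℝ)) * (if j = i then 1 else 0) := by
      simp [evalE, MvPolynomial.pderiv_X, Pi.single_apply, eq_comm]
      split_ifs <;> simp [mul_comm, add_comm]
    rw [e]
    refine h.congr_of_eventuallyEq (Filter.Eventually.of_forall fun t => ?_)
    simp [evalE]

/-- Integration in polar coordinates of a product of a homogeneous and a radial function. -/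
lemma integral_mul_radial (n : ℕ) (q : ℕ) (f : Eu n → ℝ)
    (hf : ∀ (r : ℝ), 0 < r → ∀ x, f (r • x) = r ^ q * f x) (w : ℝ → ℝ) :
    ∫ x, f x * w ‖x‖ = (∫ ω, f ω ∂(surf n)) * ∫ r in Set.Ioi (0 : ℝ), r ^ (n + q) * w r := by
  have hdim : Module.finrank ℝ (Eu n) - 1 = n := by simp
  calc
    ∫ x, f x * w ‖x‖ = ∫ x : ({(0 : Eu n)}ᶜ : Set (Eu n)), f x.1 * w ‖x.1‖
        ∂((volume : Measure (Eu n)).comap (↑)) := by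
      rw [integral_subtype_comap (measurableSet_singleton _).compl fun x : Eu n ↦ f x * w ‖x‖,
        restrict_compl_singleton]
    _ = ∫ z : Sph n × Set.Ioi (0 : ℝ), f z.1 * ((z.2 : ℝ) ^ q * w z.2)
        ∂(surf n).prod (.volumeIoiPow (Module.finrank ℝ (Eu n) - 1)) := by
      rw [← (volume : Measure (Eu n)).measurePreserving_homeomorphUnitSphereProd.integral_comp
        (Homeomorph.measurableEmbedding _)]
      congr 1
      ext x
      have hx : (0 : ℝ) < ‖x.1‖ := norm_pos_iff.2 x.2
      have h2 := hf ‖x.1‖ hx (homeomorphUnitSphereProd (Eu n) x).1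
      simp only [homeomorphUnitSphereProd_apply_fst_coe, homeomorphUnitSphereProd_apply_snd_coe]
        at h2 ⊢
      rw [smul_smul, mul_inv_cancel₀ hx.ne', one_smul] at h2
      rw [h2]; ring
    _ = (∫ ω, f ω ∂(surf n)) * ∫ r : Set.Ioi (0 : ℝ), (r : ℝ) ^ q * w r
          ∂(.volumeIoiPow (Module.finrank ℝ (Eu n) - 1)) :=
      integral_prod_mul (fun ω : Sph n => f ω) (fun r : Set.Ioi (0 : ℝ) => (r : ℝ) ^ q * w r)
    _ = _ := by
      rw [hdim]
      congr 1
      simp only [Measure.volumeIoiPow, ENNReal.ofReal]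
      rw [integral_withDensity_eq_integral_smul,
        integral_subtype_comap measurableSet_Ioi fun a ↦ Real.toNNReal (a ^ n) • (a ^ q * w a),
        setIntegral_congr_fun measurableSet_Ioi fun x hx ↦ ?_]
      · rw [NNReal.smul_def, Real.coe_toNNReal _ (pow_nonneg hx.out.le _), smul_eq_mul]; ring
      · exact (measurable_subtype_coe.pow_const _).real_toNNReal

/-- A smooth cutoff on the half-line. -/
def cutoff (t : ℝ) : ℝ := Real.smoothTransition (1 - t)

lemma contDiff_cutoff : ContDiff ℝ 1 cutoff :=
  Real.smoothTransition.contDiff.comp (contDiff_const.sub contDiff_id)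

lemma hasDerivAt_cutoff (t : ℝ) : HasDerivAt cutoff (deriv cutoff t) t :=
  (contDiff_cutoff.differentiable one_ne_zero t).hasDerivAt

lemma cutoff_eq_zero {t : ℝ} (ht : 1 ≤ t) : cutoff t = 0 :=
  Real.smoothTransition.zero_of_nonpos (by linarith)

lemma deriv_cutoff_eq_zero {t : ℝ} (ht : 1 < t) : deriv cutoff t = 0 := by
  have : cutoff =ᶠ[𝓝 t] fun _ => 0 := by
    filter_upwards [lt_mem_nhds ht] with x hx using cutoff_eq_zero hx.le
  rw [this.deriv_eq]; simp

lemma continuous_deriv_cutoff : Continuous (deriv cutoff) :=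
  contDiff_cutoff.continuous_deriv le_rfl

/-- Integration by parts for r^m cutoff(r²); m ≥ 1 removes the boundary term at 0. The factor m
becomes the constant q + n of the divergence theorem. -/
lemma integral_deriv_cutoff (m : ℕ) (hm : 1 ≤ m) :
    ∫ r in Set.Ioi (0 : ℝ), r ^ m * (deriv cutoff (r ^ 2) * (2 * r)) =
      -(m * ∫ r in Set.Ioi (0 : ℝ), r ^ (m - 1) * cutoff (r ^ 2)) := by
  have hd : ∀ r : ℝ, HasDerivAt (fun r => r ^ m * cutoff (r ^ 2))
      (m * (r ^ (m - 1) * cutoff (r ^ 2)) + r ^ m * (deriv cutoff (r ^ 2) * (2 * r))) r := by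
    intro r
    have h1 := hasDerivAt_pow m r
    have h2 : HasDerivAt (fun r : ℝ => cutoff (r ^ 2)) (deriv cutoff (r ^ 2) * (2 * r)) r := by
      simpa [Function.comp_def] using (hasDerivAt_cutoff (r ^ 2)).comp r (hasDerivAt_pow 2 r)
    refine (h1.mul h2).congr_deriv ?_
    ring
  have hsupp : ∀ f : ℝ → ℝ, (∀ r, 1 < r ^ 2 → f r = 0) → HasCompactSupport f := by
    intro f hf
    refine HasCompactSupport.intro (isCompact_Icc (a := (-1 : ℝ)) (b := 1)) fun r hr => hf r ?_
    by_contra h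
    exact hr (abs_le.1 (abs_le_of_sq_le_sq (by simpa using not_lt.1 h) zero_le_one))
  have c1 : Continuous fun r : ℝ => (m : ℝ) * (r ^ (m - 1) * cutoff (r ^ 2)) := by
    have := contDiff_cutoff.continuous
    fun_prop
  have c2 : Continuous fun r : ℝ => r ^ m * (deriv cutoff (r ^ 2) * (2 * r)) := by
    have := continuous_deriv_cutoff
    fun_prop
  have i1 : Integrable fun r : ℝ => (m : ℝ) * (r ^ (m - 1) * cutoff (r ^ 2)) :=
    c1.integrable_of_hasCompactSupport (hsupp _ fun r hr => by simp [cutoff_eq_zero hr.le])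
  have i2 : Integrable fun r : ℝ => r ^ m * (deriv cutoff (r ^ 2) * (2 * r)) :=
    c2.integrable_of_hasCompactSupport (hsupp _ fun r hr => by simp [deriv_cutoff_eq_zero hr])
  have key := integral_Ioi_of_hasDerivAt_of_tendsto (a := 0) (m := 0)
    (f := fun r => r ^ m * cutoff (r ^ 2)) (hd 0).continuousAt.continuousWithinAt
    (fun r _ => hd r) (i1.add i2).integrableOn (by
      refine tendsto_const_nhds.congr' ?_
      filter_upwards [Filter.eventually_ge_atTop 1] with r hr
      simp [cutoff_eq_zero (show 1 ≤ r ^ 2 by nlinarith)])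
  rw [integral_add i1.integrableOn i2.integrableOn, integral_const_mul] at key
  simp [show m ≠ 0 by omega] at key
  linarith

lemma integral_cutoff_pos (m : ℕ) :
    0 < ∫ r in Set.Ioi (0 : ℝ), r ^ m * cutoff (r ^ 2) := by
  have hc : Continuous fun r : ℝ => r ^ m * cutoff (r ^ 2) := by
    have := contDiff_cutoff.continuous
    fun_prop
  have hi : Integrable fun r : ℝ => r ^ m * cutoff (r ^ 2) := by
    refine hc.integrable_of_hasCompactSupport
      (HasCompactSupport.intro (isCompact_Icc (a := (-1 : ℝ)) (b := 1)) fun r hr => ?_)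
    have : 1 < r ^ 2 := by
      by_contra h
      exact hr (abs_le.1 (abs_le_of_sq_le_sq (by simpa using not_lt.1 h) zero_le_one))
    simp [cutoff_eq_zero this.le]
  rw [setIntegral_pos_iff_support_of_nonneg_ae]
  · refine lt_of_lt_of_le (b := volume (Set.Ioo (0 : ℝ) 1)) (by simp) (measure_mono fun r hr => ?_)
    refine ⟨?_, hr.1⟩
    have : 0 < cutoff (r ^ 2) := Real.smoothTransition.pos_of_pos (by nlinarith [hr.1, hr.2])
    exact (mul_pos (pow_pos hr.1 m) this).ne'
  · filter_upwards [ae_restrict_mem measurableSet_Ioi] with r hr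
    exact mul_nonneg (pow_nonneg (le_of_lt hr) m) (Real.smoothTransition.nonneg _)
  · exact hi.integrableOn

/-! ### Divergence theorem and Green's formula on the sphere -/

/-- The integral of a polynomial over the sphere. -/
def polyIntegral (n : ℕ) : MvPolynomial (Fin (n + 1)) ℝ →ₗ[ℝ] ℝ where
  toFun p := ∫ ω, restrictPoly n p ω ∂(surf n)
  map_add' p q := by
    simp only [map_add, ContinuousMap.add_apply]
    exact integral_add ((restrictPoly n p).continuous.integrable_of_hasCompactSupport
      (HasCompactSupport.of_compactSpace _)) ((restrictPoly n q).continuous.integrable_of_hasCompactSupport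
      (HasCompactSupport.of_compactSpace _))
  map_smul' c p := by
    simp only [map_smul, ContinuousMap.smul_apply, smul_eq_mul, RingHom.id_apply]
    exact integral_const_mul _ _

/-- The divergence theorem on the sphere, for homogeneous polynomials. -/
theorem polyIntegral_pderiv {n q : ℕ} (hn : 1 ≤ n) {Q : MvPolynomial (Fin (n + 1)) ℝ}
    (hQ : Q.IsHomogeneous q) (i : Fin (n + 1)) :
    polyIntegral n (MvPolynomial.pderiv i Q) =
      (q + n) * polyIntegral n (MvPolynomial.X i * Q) := by
  -- With a cutoff depending on ‖x‖², the i-th derivative is x i times a radial function, so both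
  -- terms of the integration by parts factor in polar coordinates.
  set g : Eu n → ℝ := fun x => cutoff (‖x‖ ^ 2) with hg
  set g' : Eu n → ℝ := fun x => deriv cutoff (‖x‖ ^ 2) * (2 * x i) with hg'
  have hgd : ∀ x, HasLineDerivAt ℝ g (g' x) x (EuclideanSpace.single i 1) := by
    intro x
    have h1 : HasDerivAt (fun t : ℝ => ‖x + t • (EuclideanSpace.single i (1 : ℝ) : Eu n)‖ ^ 2)
        (2 * x i) 0 := by
      have := ((hasDerivAt_id (0 : ℝ)).smul_const (EuclideanSpace.single i (1 : ℝ) : Eu n)).const_add x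
        |>.norm_sq
      simpa [EuclideanSpace.inner_single_right] using this
    have h2 := hasDerivAt_cutoff (‖x + (0 : ℝ) • (EuclideanSpace.single i (1 : ℝ) : Eu n)‖ ^ 2)
    have := h2.comp (0 : ℝ) h1
    simpa [HasLineDerivAt, hg, hg', Function.comp_def] using this
  have hcg : Continuous g := contDiff_cutoff.continuous.comp (by fun_prop)
  have hcg' : Continuous g' := (continuous_deriv_cutoff.comp (by fun_prop)).mul (by fun_prop)
  have hsg : ∀ f : Eu n → ℝ, HasCompactSupport fun x => f x * g x := fun f => by
    refine HasCompactSupport.intro (isCompact_closedBall (0 : Eu n) 1) fun x hx => ?_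
    have : 1 < ‖x‖ := by simpa using hx
    simp [hg, cutoff_eq_zero (show 1 ≤ ‖x‖ ^ 2 by nlinarith)]
  have hsg' : ∀ f : Eu n → ℝ, HasCompactSupport fun x => f x * g' x := fun f => by
    refine HasCompactSupport.intro (isCompact_closedBall (0 : Eu n) 1) fun x hx => ?_
    have : 1 < ‖x‖ := by simpa using hx
    simp [hg', deriv_cutoff_eq_zero (show 1 < ‖x‖ ^ 2 by nlinarith)]
  have key := integral_bilinear_hasLineDerivAt_right_eq_neg_left_of_integrable
    (μ := (volume : Measure (Eu n))) (B := ContinuousLinearMap.mul ℝ ℝ)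
    (f := evalE n Q) (f' := evalE n (MvPolynomial.pderiv i Q)) (g := g) (g' := g')
    (v := EuclideanSpace.single i 1)
    (((continuous_evalE n _).mul hcg).integrable_of_hasCompactSupport (hsg _))
    (((continuous_evalE n _).mul hcg').integrable_of_hasCompactSupport (hsg' _))
    (((continuous_evalE n _).mul hcg).integrable_of_hasCompactSupport (hsg _))
    (fun x _ => hasLineDerivAt_evalE n Q i x) (fun x _ => hgd x)
  simp only [ContinuousLinearMap.mul_apply'] at key
  have hXQ : (MvPolynomial.X i * Q).IsHomogeneous (1 + q) := (MvPolynomial.isHomogeneous_X ℝ i).mul hQ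
  have e1 : ∫ x, evalE n Q x * g' x = ∫ x, evalE n (MvPolynomial.X i * Q) x *
      (fun r => 2 * deriv cutoff (r ^ 2)) ‖x‖ := by
    congr 1; ext x; simp [hg', evalE]; ring
  rw [e1, integral_mul_radial n (1 + q) _ (fun r _ x => evalE_smul hXQ r x)
    (fun r => 2 * deriv cutoff (r ^ 2))] at key
  have e2 : ∫ r in Set.Ioi (0 : ℝ), r ^ (n + (1 + q)) * (2 * deriv cutoff (r ^ 2)) =
      ∫ r in Set.Ioi (0 : ℝ), r ^ (n + q) * (deriv cutoff (r ^ 2) * (2 * r)) := by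
    congr 1; ext r; ring
  rw [e2, integral_deriv_cutoff _ (by omega)] at key
  have hpos := integral_cutoff_pos (n + q - 1)
  have e3 : ∫ x, evalE n (MvPolynomial.pderiv i Q) x * g x =
      polyIntegral n (MvPolynomial.pderiv i Q) *
        ∫ r in Set.Ioi (0 : ℝ), r ^ (n + q - 1) * cutoff (r ^ 2) := by
    -- The degree q - 1 is truncated at q = 0, where the derivative is the zero polynomial.
    rcases Nat.eq_zero_or_pos q with rfl | hq
    · have : MvPolynomial.pderiv i Q = 0 := by
        rw [MvPolynomial.totalDegree_eq_zero_iff_eq_C.1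
          ((MvPolynomial.totalDegree_zero_iff_isHomogeneous (p := Q)).2 hQ), MvPolynomial.pderiv_C]
      simp [this, evalE]
    · have := integral_mul_radial n (q - 1) (evalE n (MvPolynomial.pderiv i Q))
        (fun r _ x => evalE_smul hQ.pderiv r x) (fun r => cutoff (r ^ 2))
      rw [show n + (q - 1) = n + q - 1 by omega] at this
      exact this
  rw [e3] at key
  have e4 : (∫ ω : Sph n, evalE n (MvPolynomial.X i * Q) ω ∂surf n) =
    polyIntegral n (MvPolynomial.X i * Q) := rfl
  rw [e4] at key
  push_cast at key
  refine mul_right_cancel₀ hpos.ne' ?_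
  linarith

open MvPolynomial in
lemma polyLaplacian_apply (n : ℕ) (p : MvPolynomial (Fin (n + 1)) ℝ) :
    polyLaplacian n p = ∑ i, pderiv i (pderiv i p) := by
  simp [polyLaplacian]

open MvPolynomial in
lemma polyLaplacian_isHomogeneous {n d : ℕ} {p : MvPolynomial (Fin (n + 1)) ℝ}
    (hp : p.IsHomogeneous (d + 2)) : (polyLaplacian n p).IsHomogeneous d := by
  rw [polyLaplacian_apply]
  exact MvPolynomial.IsHomogeneous.sum _ _ _ fun i _ => hp.pderiv.pderiv

open MvPolynomial in
lemma polyLaplacian_eq_zero_of_lt {n d : ℕ} {p : MvPolynomial (Fin (n + 1)) ℝ}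
    (hp : p.IsHomogeneous d) (hd : d < 2) : polyLaplacian n p = 0 := by
  rw [polyLaplacian_apply]
  refine Finset.sum_eq_zero fun i _ => ?_
  have h : (pderiv i p).IsHomogeneous 0 := by
    have := hp.pderiv (i := i)
    rwa [show d - 1 = 0 by omega] at this
  rw [totalDegree_eq_zero_iff_eq_C.1 ((totalDegree_zero_iff_isHomogeneous (p := pderiv i p)).2 h),
    pderiv_C]

open MvPolynomial in
-- The divergence theorem for B ∂ᵢA, summed over i, with Euler's identity ∑ xᵢ ∂ᵢA = p A. The
-- gradient term is symmetric in A and B, so it cancels in Green's formula.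
lemma polyIntegral_mul_laplacian {n p q : ℕ} (hn : 1 ≤ n) {A B : MvPolynomial (Fin (n + 1)) ℝ}
    (hA : A.IsHomogeneous p) (hB : B.IsHomogeneous q) :
    polyIntegral n (B * polyLaplacian n A) + ∑ i, polyIntegral n (pderiv i B * pderiv i A) =
      (p + q + n - 1) * p * polyIntegral n (A * B) := by
  rw [polyLaplacian_apply, Finset.mul_sum, map_sum, ← Finset.sum_add_distrib]
  rcases Nat.eq_zero_or_pos p with rfl | hp
  · have h0 : ∀ i, pderiv i A = 0 := fun i => by
      rw [totalDegree_eq_zero_iff_eq_C.1 ((totalDegree_zero_iff_isHomogeneous (p := A)).2 hA),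
        pderiv_C]
    simp [h0]
  have h1 : ∀ i, polyIntegral n (B * pderiv i (pderiv i A)) +
      polyIntegral n (pderiv i B * pderiv i A) =
        (p + q + n - 1) * polyIntegral n (B * (X i * pderiv i A)) := by
    intro i
    have h := polyIntegral_pderiv hn (hB.mul (hA.pderiv (i := i))) i
    rw [(pderiv i).leibniz, smul_eq_mul, smul_eq_mul, map_add, mul_comm (pderiv i A)] at h
    rw [h, Nat.cast_add, Nat.cast_sub hp]
    rw [show X i * (B * pderiv i A) = B * (X i * pderiv i A) by ring]
    push_cast
    ring
  rw [Finset.sum_congr rfl fun i _ => h1 i, ← Finset.mul_sum, ← map_sum, ← Finset.mul_sum,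
    hA.sum_X_mul_pderiv, mul_smul_comm, map_nsmul, mul_comm B A, nsmul_eq_mul]
  ring

/-- Green's formula for homogeneous polynomials on the sphere. -/
theorem polyIntegral_green {n p q : ℕ} (hn : 1 ≤ n) {A B : MvPolynomial (Fin (n + 1)) ℝ}
    (hA : A.IsHomogeneous p) (hB : B.IsHomogeneous q) :
    polyIntegral n (B * polyLaplacian n A) - polyIntegral n (A * polyLaplacian n B) =
      ((p : ℝ) + q + n - 1) * (p - q) * polyIntegral n (A * B) := by
  have h1 := polyIntegral_mul_laplacian hn hA hB
  have h2 := polyIntegral_mul_laplacian hn hB hA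
  simp only [mul_comm (MvPolynomial.pderiv _ A), mul_comm B A] at h2
  linear_combination h1 - h2

/-- In Green's formula the term with ΔA vanishes, and so does the one with ΔB by induction, its
degree being q - 2; the factor (p + q + n - 1)(p - q) is nonzero. B need not be harmonic, which the
Fischer decomposition and the moments below require. -/
lemma polyIntegral_mul_harmonic_eq_zero {n p : ℕ} (hn : 1 ≤ n) {A : MvPolynomial (Fin (n + 1)) ℝ}
    (hA : A.IsHomogeneous p) (hA0 : polyLaplacian n A = 0) (q : ℕ) (hq : q < p)
    (B : MvPolynomial (Fin (n + 1)) ℝ) (hB : B.IsHomogeneous q) :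
    polyIntegral n (A * B) = 0 := by
  induction q using Nat.strong_induction_on generalizing B with
  | _ q ih =>
    have h := polyIntegral_green hn hA hB
    have h2 : polyIntegral n (A * polyLaplacian n B) = 0 := by
      by_cases h2 : q < 2
      · rw [polyLaplacian_eq_zero_of_lt hB h2]; simp
      · obtain ⟨d, rfl⟩ : ∃ d, q = d + 2 := ⟨q - 2, by omega⟩
        exact ih d (by omega) (by omega) _ (polyLaplacian_isHomogeneous hB)
    rw [hA0, h2, mul_zero, map_zero, sub_zero] at h
    have hn' : (1 : ℝ) ≤ n := by exact_mod_cast hn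
    have hq' : (q : ℝ) + 1 ≤ p := by exact_mod_cast hq
    have hq0 : (0 : ℝ) ≤ q := q.cast_nonneg
    refine (mul_eq_zero.1 h.symm).resolve_left (mul_ne_zero ?_ ?_) <;> linarith

/-! ### Completeness of the spherical harmonics -/

lemma continuous_integrable {n : ℕ} {f : Sph n → ℝ} (hf : Continuous f) : Integrable f (surf n) :=
  hf.integrable_of_hasCompactSupport (HasCompactSupport.of_compactSpace _)

lemma integral_pos_of_nonneg_of_ne {n : ℕ} {f : Sph n → ℝ} (hf : Continuous f)
    (h0 : ∀ ω, 0 ≤ f ω) {ω₀ : Sph n} (h : f ω₀ ≠ 0) : 0 < ∫ ω, f ω ∂(surf n) :=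
  hf.integral_pos_of_hasCompactSupport_nonneg_nonzero (HasCompactSupport.of_compactSpace _) h0 h

instance (n : ℕ) : Nonempty (Sph n) := ⟨⟨EuclideanSpace.single 0 1, by simp⟩⟩

lemma exists_smul_sphere {n : ℕ} (x : Eu n) : ∃ ω : Sph n, x = ‖x‖ • (ω : Eu n) := by
  by_cases hx : x = 0
  · exact ⟨Classical.arbitrary _, by simp [hx]⟩
  · have h : ‖x‖ ≠ 0 := norm_ne_zero_iff.2 hx
    exact ⟨⟨‖x‖⁻¹ • x, by simp [norm_smul, h]⟩, by simp [smul_smul, h]⟩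

lemma eq_zero_of_polyIntegral_sq {n d : ℕ} {A : MvPolynomial (Fin (n + 1)) ℝ}
    (hA : A.IsHomogeneous d) (h : polyIntegral n (A * A) = 0) : A = 0 := by
  have h0 : ∀ ω : Sph n, evalE n A ω = 0 := by
    intro ω
    by_contra hω
    refine (integral_pos_of_nonneg_of_ne (f := restrictPoly n (A * A)) (restrictPoly n (A * A)).continuous
      (fun ω => ?_) (ω₀ := ω) ?_).ne' h
    · simp only [restrictPoly_apply, evalE, map_mul]; exact mul_self_nonneg _
    · simpa [restrictPoly_apply, evalE] using hω
  refine MvPolynomial.funext fun x => ?_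
  obtain ⟨ω, hω⟩ := exists_smul_sphere (n := n) (WithLp.toLp 2 x)
  have := evalE_smul hA ‖(WithLp.toLp 2 x : Eu n)‖ ω
  rw [← hω, h0, mul_zero] at this
  simpa [evalE] using this

/-- The polynomial `∑ᵢ xᵢ²`. -/
def normSqPoly (n : ℕ) : MvPolynomial (Fin (n + 1)) ℝ := ∑ i, MvPolynomial.X i ^ 2

lemma normSqPoly_isHomogeneous (n : ℕ) : (normSqPoly n).IsHomogeneous 2 :=
  MvPolynomial.IsHomogeneous.sum _ _ _ fun i _ => MvPolynomial.isHomogeneous_X_pow i 2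

lemma restrictPoly_mul (n : ℕ) (p q : MvPolynomial (Fin (n + 1)) ℝ) :
    restrictPoly n (p * q) = restrictPoly n p * restrictPoly n q := by
  ext ω; simp [restrictPoly_apply, evalE]

lemma restrictPoly_normSqPoly (n : ℕ) : restrictPoly n (normSqPoly n) = 1 := by
  ext ω
  have h : ‖(ω : Eu n)‖ ^ 2 = 1 := by simp
  rw [EuclideanSpace.norm_sq_eq] at h
  simpa [restrictPoly_apply, evalE, normSqPoly] using h

/-- The map B ↦ Δ(|x|² B) on forms of degree d is injective: if |x|² B is harmonic, it is orthogonal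
to B, which has lower degree, and |x|² = 1 on the sphere gives ∫ B² = 0. In finite dimension it is
then surjective. -/
lemma fischer {n d : ℕ} (hn : 1 ≤ n) {A : MvPolynomial (Fin (n + 1)) ℝ}
    (hA : A.IsHomogeneous (d + 2)) :
    ∃ B : MvPolynomial (Fin (n + 1)) ℝ, B.IsHomogeneous d ∧
      polyLaplacian n (A - normSqPoly n * B) = 0 := by
  let V := MvPolynomial.homogeneousSubmodule (Fin (n + 1)) ℝ d
  have : FiniteDimensional ℝ V := Module.Finite.iff_fg.mpr (MvPolynomial.homogeneousSubmodule_fg _ _ d)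
  have hB : ∀ B ∈ V, (normSqPoly n * B).IsHomogeneous (d + 2) := fun B hB => by
    rw [add_comm d 2]; exact (normSqPoly_isHomogeneous n).mul hB
  let L : V →ₗ[ℝ] V := ((polyLaplacian n) ∘ₗ (LinearMap.mulLeft ℝ (normSqPoly n))).restrict
    (fun B hB' => polyLaplacian_isHomogeneous (hB B hB'))
  have hL : Function.Injective L := by
    rw [← LinearMap.ker_eq_bot, LinearMap.ker_eq_bot']
    rintro ⟨B, hB'⟩ h
    have h1 : polyLaplacian n (normSqPoly n * B) = 0 := congrArg Subtype.val h
    have h2 := polyIntegral_mul_harmonic_eq_zero hn (hB B hB') h1 d (by omega) B hB'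
    have h3 : polyIntegral n (normSqPoly n * B * B) = polyIntegral n (B * B) := by
      change ∫ ω, restrictPoly n _ ω ∂_ = ∫ ω, restrictPoly n _ ω ∂_
      rw [mul_assoc, restrictPoly_mul, restrictPoly_normSqPoly, one_mul]
    exact Subtype.ext (eq_zero_of_polyIntegral_sq hB' (h3 ▸ h2))
  obtain ⟨⟨B, hB'⟩, h⟩ := LinearMap.injective_iff_surjective.1 hL
    ⟨polyLaplacian n A, polyLaplacian_isHomogeneous hA⟩
  refine ⟨B, hB', ?_⟩
  have h1 : polyLaplacian n (normSqPoly n * B) = polyLaplacian n A := congrArg Subtype.val h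
  rw [map_sub, h1, sub_self]

lemma toL2_mem_sphericalHarmonics {n ℓ : ℕ} {A : MvPolynomial (Fin (n + 1)) ℝ}
    (hA : A.IsHomogeneous ℓ) (hA0 : polyLaplacian n A = 0) :
    toL2 n (restrictPoly n A) ∈ sphericalHarmonics n ℓ :=
  ⟨A, ⟨hA, hA0⟩, rfl⟩

lemma toL2_mem_iSup_of_isHomogeneous {n : ℕ} (hn : 1 ≤ n) (d : ℕ)
    (A : MvPolynomial (Fin (n + 1)) ℝ) (hA : A.IsHomogeneous d) :
    toL2 n (restrictPoly n A) ∈ ⨆ ℓ, sphericalHarmonics n ℓ := by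
  induction d using Nat.strong_induction_on generalizing A with
  | _ d ih =>
    by_cases hd : d < 2
    · exact Submodule.mem_iSup_of_mem d
        (toL2_mem_sphericalHarmonics hA (polyLaplacian_eq_zero_of_lt hA hd))
    · obtain ⟨d, rfl⟩ : ∃ e, d = e + 2 := ⟨d - 2, by omega⟩
      obtain ⟨B, hB, h⟩ := fischer hn hA
      have hBn : (normSqPoly n * B).IsHomogeneous (d + 2) := by
        rw [add_comm d 2]; exact (normSqPoly_isHomogeneous n).mul hB
      have e : toL2 n (restrictPoly n A) =
          toL2 n (restrictPoly n (A - normSqPoly n * B)) + toL2 n (restrictPoly n B) := by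
        rw [← map_add, map_sub, restrictPoly_mul, restrictPoly_normSqPoly, one_mul, sub_add_cancel]
      rw [e]
      exact add_mem (Submodule.mem_iSup_of_mem (d + 2)
        (toL2_mem_sphericalHarmonics (hA.sub hBn) h)) (ih d (by omega) B hB)

lemma toL2_restrictPoly_mem_iSup {n : ℕ} (hn : 1 ≤ n) (A : MvPolynomial (Fin (n + 1)) ℝ) :
    toL2 n (restrictPoly n A) ∈ ⨆ ℓ, sphericalHarmonics n ℓ := by
  rw [← MvPolynomial.sum_homogeneousComponent A, map_sum, map_sum]
  exact sum_mem fun d _ => toL2_mem_iSup_of_isHomogeneous hn d _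
    (MvPolynomial.homogeneousComponent_isHomogeneous d A)

lemma dense_range_restrictPoly (n : ℕ) : DenseRange (restrictPoly n) := by
  let S : Subalgebra ℝ C(Sph n, ℝ) :=
    { (LinearMap.range (restrictPoly n)) with
      mul_mem' := by
        rintro _ _ ⟨p, rfl⟩ ⟨q, rfl⟩
        exact ⟨p * q, restrictPoly_mul n p q⟩
      algebraMap_mem' := fun r => ⟨MvPolynomial.C r, by ext; simp [restrictPoly_apply, evalE]⟩ }
  have hS : S.SeparatesPoints := by
    intro x y hxy
    obtain ⟨i, hi⟩ : ∃ i, (x : Eu n) i ≠ (y : Eu n) i := by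
      by_contra! h
      exact hxy (Subtype.ext (by ext i; exact h i))
    exact ⟨_, ⟨restrictPoly n (MvPolynomial.X i), ⟨MvPolynomial.X i, rfl⟩, rfl⟩, by
      simpa [restrictPoly_apply, evalE] using hi⟩
  have h := ContinuousMap.subalgebra_topologicalClosure_eq_top_of_separatesPoints S hS
  intro f
  have : f ∈ S.topologicalClosure := h ▸ trivial
  exact this

lemma topologicalClosure_iSup_sphericalHarmonics {n : ℕ} (hn : 1 ≤ n) :
    (⨆ ℓ, sphericalHarmonics n ℓ).topologicalClosure = ⊤ := by
  have h1 : DenseRange (toL2 n) := ContinuousMap.toLp_denseRange ℝ (surf n) ℝ (by simp)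
  have h2 : DenseRange (toL2 n ∘ restrictPoly n) :=
    h1.comp (dense_range_restrictPoly n) (toL2 n).continuous
  rw [eq_top_iff]
  rintro u -
  refine closure_mono ?_ (h2 u)
  rintro _ ⟨A, rfl⟩
  exact toL2_restrictPoly_mem_iSup hn A

lemma inner_toL2 {n : ℕ} (f g : C(Sph n, ℝ)) :
    inner ℝ (toL2 n f) (toL2 n g) = ∫ ω, f ω * g ω ∂(surf n) := by
  rw [toL2, ContinuousMap.inner_toLp]
  simp [mul_comm]

lemma inner_toL2_restrictPoly {n : ℕ} (A B : MvPolynomial (Fin (n + 1)) ℝ) :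
    inner ℝ (toL2 n (restrictPoly n A)) (toL2 n (restrictPoly n B)) = polyIntegral n (A * B) := by
  rw [inner_toL2]
  change _ = ∫ ω, restrictPoly n _ ω ∂_
  rw [restrictPoly_mul]; rfl

lemma orthogonalFamily_sphericalHarmonics {n : ℕ} (hn : 1 ≤ n) :
    OrthogonalFamily ℝ (fun ℓ => sphericalHarmonics n ℓ)
      (fun ℓ => (sphericalHarmonics n ℓ).subtypeₗᵢ) := by
  have key : ∀ i j, j < i → ∀ A B : MvPolynomial (Fin (n + 1)) ℝ, A.IsHomogeneous i →
      polyLaplacian n A = 0 → B.IsHomogeneous j → polyIntegral n (A * B) = 0 :=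
    fun i j hij A B hA hA0 hB => polyIntegral_mul_harmonic_eq_zero hn hA hA0 j hij B hB
  rintro i j hij ⟨_, A, ⟨hA, hA0⟩, rfl⟩ ⟨_, B, ⟨hB, hB0⟩, rfl⟩
  change inner ℝ (toL2 n (restrictPoly n A)) (toL2 n (restrictPoly n B)) = 0
  rw [inner_toL2_restrictPoly]
  rcases lt_or_gt_of_ne hij with h | h
  · rw [mul_comm]; exact key j i h B A hB hB0 hA
  · exact key i j h A B hA hA0 hB

theorem isHilbertSum_sphericalHarmonics {n : ℕ} (hn : 1 ≤ n) :
    IsHilbertSum ℝ (fun ℓ => sphericalHarmonics n ℓ)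
      (fun ℓ => (sphericalHarmonics n ℓ).subtypeₗᵢ) :=
  IsHilbertSum.mkInternal _ (orthogonalFamily_sphericalHarmonics hn)
    (topologicalClosure_iSup_sphericalHarmonics hn).ge

lemma P_eq_linearIsometryEquiv {n : ℕ} (hn : 1 ≤ n) (u : L2 n) (ℓ : ℕ) :
    P n ℓ u = ((isHilbertSum_sphericalHarmonics hn).linearIsometryEquiv u ℓ : L2 n) := by
  set hV := isHilbertSum_sphericalHarmonics hn
  set w := hV.linearIsometryEquiv u with hw
  have h1 := hV.hasSum_linearIsometryEquiv_symm w
  rw [hw, LinearIsometryEquiv.symm_apply_apply, ← hw] at h1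
  have h2 := h1.mapL (P n ℓ)
  refine h2.unique ?_
  have h3 : P n ℓ (w ℓ : L2 n) = w ℓ :=
    Submodule.starProjection_eq_self_iff.2 (w ℓ).2
  have := hasSum_single (f := fun i => P n ℓ ((sphericalHarmonics n i).subtypeₗᵢ (w i))) ℓ
    fun j hj => by
      refine (Submodule.starProjection_apply_eq_zero_iff _).2 ?_
      intro v hv
      exact orthogonalFamily_sphericalHarmonics hn hj.symm ⟨v, hv⟩ (w j)
  simpa [h3] using this

/-- Parseval's identity for the decomposition into spherical harmonics. -/
theorem hasSum_inner_P {n : ℕ} (hn : 1 ≤ n) (u v : L2 n) :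
    HasSum (fun ℓ => inner ℝ (P n ℓ u) (P n ℓ v)) (inner ℝ u v) := by
  have h := lp.hasSum_inner (𝕜 := ℝ) ((isHilbertSum_sphericalHarmonics hn).linearIsometryEquiv u)
    ((isHilbertSum_sphericalHarmonics hn).linearIsometryEquiv v)
  rw [LinearIsometryEquiv.inner_map_map] at h
  simp only [P_eq_linearIsometryEquiv hn]
  exact h

/-- Reduces identities between projections to integrals against harmonic polynomials. -/
lemma P_eq_iff {n ℓ : ℕ} (u v : L2 n) :
    P n ℓ u = P n ℓ v ↔ ∀ A : MvPolynomial (Fin (n + 1)) ℝ, A.IsHomogeneous ℓ →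
      polyLaplacian n A = 0 →
        inner ℝ (toL2 n (restrictPoly n A)) u = inner ℝ (toL2 n (restrictPoly n A)) v := by
  rw [← sub_eq_zero, ← map_sub, P, Submodule.starProjection_apply_eq_zero_iff]
  constructor
  · intro h A hA hA0
    have := h _ (toL2_mem_sphericalHarmonics hA hA0)
    rwa [inner_sub_right, sub_eq_zero] at this
  · rintro h _ ⟨A, ⟨hA, hA0⟩, rfl⟩
    rw [inner_sub_right, sub_eq_zero]
    exact h A hA hA0

/-! ### Moments of a spherical harmonic along a direction -/

/-- The linear form `x ↦ e · x` as a polynomial. -/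
def linPoly {n : ℕ} (e : Eu n) : MvPolynomial (Fin (n + 1)) ℝ :=
  ∑ i, MvPolynomial.C (e i) * MvPolynomial.X i

lemma linPoly_isHomogeneous {n : ℕ} (e : Eu n) : (linPoly e).IsHomogeneous 1 :=
  MvPolynomial.IsHomogeneous.sum _ _ _ fun i _ => MvPolynomial.isHomogeneous_C_mul_X _ i

lemma restrictPoly_linPoly {n : ℕ} (e : Eu n) (ω : Sph n) :
    restrictPoly n (linPoly e) ω = inner ℝ e (ω : Eu n) := by
  simp [restrictPoly_apply, evalE, linPoly, PiLp.inner_apply, mul_comm]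

lemma restrictPoly_linPoly_pow {n : ℕ} (e : Eu n) (k : ℕ) (ω : Sph n) :
    restrictPoly n (linPoly e ^ k) ω = inner ℝ e (ω : Eu n) ^ k := by
  rw [← restrictPoly_linPoly]; simp [restrictPoly_apply, evalE]

open MvPolynomial in
lemma pderiv_linPoly {n : ℕ} (e : Eu n) (i : Fin (n + 1)) : pderiv i (linPoly e) = C (e i) := by
  rw [linPoly, map_sum, Finset.sum_eq_single i]
  · simp
  · intro j _ hj
    simp [pderiv_X, hj.symm]
  · simp

open MvPolynomial in
lemma polyLaplacian_linPoly_pow {n : ℕ} (e : Eu n) (k : ℕ) :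
    polyLaplacian n (linPoly e ^ (k + 2)) =
      ((k + 2 : ℝ) * (k + 1) * ‖e‖ ^ 2) • linPoly e ^ k := by
  have h : ∀ i, pderiv i (pderiv i (linPoly e ^ (k + 2))) =
      ((k + 2 : ℝ) * (k + 1) * (e i) ^ 2) • linPoly e ^ k := by
    intro i
    rw [pderiv_pow, pderiv_linPoly, (pderiv i).leibniz, pderiv_C, smul_zero, zero_add,
      (pderiv i).leibniz, Derivation.map_natCast]
    simp only [show k + 2 - 1 = k + 1 by omega, pderiv_pow, pderiv_linPoly, Nat.add_sub_cancel, smul_eq_mul,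
      smul_eq_C_mul]
    push_cast
    simp only [map_mul, map_add, map_pow, map_natCast, map_ofNat, map_one]
    ring
  rw [polyLaplacian_apply, Finset.sum_congr rfl fun i _ => h i, ← Finset.sum_smul,
    ← Finset.mul_sum, EuclideanSpace.norm_sq_eq]
  simp

/-- The moments `∫ A(ω) (e · ω)ᵏ`. -/
def moment {n : ℕ} (A : MvPolynomial (Fin (n + 1)) ℝ) (e : Eu n) (k : ℕ) : ℝ :=
  polyIntegral n (A * linPoly e ^ k)

lemma moment_eq {n : ℕ} (A : MvPolynomial (Fin (n + 1)) ℝ) (e : Eu n) (k : ℕ) :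
    moment A e k = ∫ ω : Sph n, restrictPoly n A ω * inner ℝ e (ω : Eu n) ^ k ∂(surf n) := by
  change ∫ ω, restrictPoly n _ ω ∂_ = _
  simp only [restrictPoly_mul, ContinuousMap.mul_apply, restrictPoly_linPoly_pow]

/-- Green's formula for A and (e·x)^(k+2), whose Laplacian is a multiple of (e·x)^k. -/
lemma moment_recurrence {n ℓ : ℕ} (hn : 1 ≤ n) {A : MvPolynomial (Fin (n + 1)) ℝ}
    (hA : A.IsHomogeneous ℓ) (hA0 : polyLaplacian n A = 0) {e : Eu n} (he : ‖e‖ = 1) (k : ℕ) :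
    ((k : ℝ) + 2 - ℓ) * (k + 2 + ℓ + n - 1) * moment A e (k + 2) =
      (k + 2) * (k + 1) * moment A e k := by
  have h := polyIntegral_green hn hA ((linPoly_isHomogeneous e).pow (k + 2))
  rw [hA0, polyLaplacian_linPoly_pow, he, mul_zero, map_zero, mul_smul_comm, map_smul] at h
  push_cast at h
  simp only [moment]
  rw [smul_eq_mul] at h
  linear_combination h

lemma moment_eq_zero_of_lt {n ℓ : ℕ} (hn : 1 ≤ n) {A : MvPolynomial (Fin (n + 1)) ℝ}
    (hA : A.IsHomogeneous ℓ) (hA0 : polyLaplacian n A = 0) (e : Eu n) {k : ℕ} (hk : k < ℓ) :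
    moment A e k = 0 :=
  polyIntegral_mul_harmonic_eq_zero hn hA hA0 k hk _ (by simpa using (linPoly_isHomogeneous e).pow k)

lemma moment_one_eq_zero {n : ℕ} (hn : 1 ≤ n) {A : MvPolynomial (Fin (n + 1)) ℝ}
    (hA : A.IsHomogeneous 0) (e : Eu n) : moment A e 1 = 0 := by
  rw [moment, mul_comm]
  exact polyIntegral_mul_harmonic_eq_zero hn (by simpa using (linPoly_isHomogeneous e).pow 1)
    (polyLaplacian_eq_zero_of_lt (by simpa using (linPoly_isHomogeneous e).pow 1) one_lt_two)
    0 one_pos A hA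

/-! ### Binomial series and the hypergeometric equation -/

/-- The Taylor coefficients of `x ↦ (1 - x) ^ κ`. -/
def binCoeff (κ : ℝ) (k : ℕ) : ℝ := (-1) ^ k * Ring.choose κ k

lemma binCoeff_zero (κ : ℝ) : binCoeff κ 0 = 1 := by simp [binCoeff]

lemma binCoeff_succ (κ : ℝ) (k : ℕ) : (k + 1) * binCoeff κ (k + 1) = (k - κ) * binCoeff κ k := by
  have h := Ring.choose_smul_choose κ (Nat.le_succ k)
  rw [Nat.succ_eq_add_one, Nat.add_sub_cancel_left, Ring.choose_one_right, Nat.choose_succ_self_right,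
    nsmul_eq_mul] at h
  push_cast at h
  simp only [binCoeff, pow_succ]
  linear_combination (-(-1) ^ k) * h

lemma factorial_mul_binCoeff (κ : ℝ) (ℓ : ℕ) :
    (ℓ.factorial : ℝ) * binCoeff κ ℓ = ∏ j ∈ Finset.range ℓ, ((j : ℝ) - κ) := by
  induction ℓ with
  | zero => simp [binCoeff_zero]
  | succ ℓ ih =>
    rw [Finset.prod_range_succ, ← ih, Nat.factorial_succ]
    push_cast
    linear_combination (ℓ.factorial : ℝ) * binCoeff_succ κ ℓ

lemma hasSum_binCoeff (κ : ℝ) {x : ℝ} (hx : |x| < 1) :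
    HasSum (fun k => binCoeff κ k * x ^ k) ((1 - x) ^ κ) := by
  have h := (Real.one_add_rpow_hasFPowerSeriesOnBall_zero (a := κ)).hasSum (y := -x) (by
    simpa [enorm_eq_nnnorm, ← NNReal.coe_lt_one] using! hx)
  simp only [binomialSeries_apply, List.ofFn_const, List.prod_replicate, smul_eq_mul, zero_add] at h
  refine (h.congr_fun fun k => ?_) 
  rw [binCoeff, neg_pow]; ring

open PowerSeries in
/-- The Euler operator `X d/dX`. -/
def eulerOp : Derivation ℝ ℝ⟦X⟧ ℝ⟦X⟧ := (X : ℝ⟦X⟧) • d⁄dX ℝ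

open PowerSeries in
lemma coeff_eulerOp (f : ℝ⟦X⟧) (k : ℕ) : coeff k (eulerOp f) = k * coeff k f := by
  change coeff k (X * d⁄dX ℝ f) = _
  cases k with
  | zero => simp
  | succ k => rw [coeff_succ_X_mul, coeff_derivative]; push_cast; ring

open PowerSeries in
lemma constantCoeff_eulerOp (f : ℝ⟦X⟧) : constantCoeff (eulerOp f) = 0 := by
  simpa using coeff_eulerOp f 0

open PowerSeries in
lemma eulerOp_X : eulerOp (X : ℝ⟦X⟧) = X := by
  change X * d⁄dX ℝ X = _
  simp

open PowerSeries in
/-- The differential equation `(θ - ℓ)(θ + ℓ + n - 1) y = X² (θ - κ)(θ - κ + 1) y`, where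
`θ = X d/dX`. -/
def SolvesODE (n ℓ : ℕ) (κ : ℝ) (y : ℝ⟦X⟧) : Prop :=
  eulerOp (eulerOp y) + C ((n : ℝ) - 1) * eulerOp y - C ((ℓ : ℝ) * (ℓ + n - 1)) * y =
    X ^ 2 * (eulerOp (eulerOp y) + C (1 - 2 * κ) * eulerOp y + C (κ * (κ - 1)) * y)

open PowerSeries in
lemma solvesODE_mk {n ℓ : ℕ} {κ : ℝ} {a : ℕ → ℝ} (h0 : (ℓ : ℝ) * (ℓ + n - 1) * a 0 = 0)
    (h1 : ((ℓ : ℝ) - 1) * (ℓ + n) * a 1 = 0)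
    (h : ∀ k : ℕ, ((k : ℝ) + 2 - ℓ) * (k + 2 + ℓ + n - 1) * a (k + 2) =
      (k - κ) * (k + 1 - κ) * a k) : SolvesODE n ℓ κ (mk a) := by
  unfold SolvesODE
  ext k
  rcases k with _ | _ | k
  · rw [coeff_X_pow_mul', if_neg (by norm_num)]
    simp only [LinearMap.map_add, LinearMap.map_sub, coeff_eulerOp, coeff_C_mul, coeff_mk]
    push_cast
    linear_combination -h0
  · rw [coeff_X_pow_mul', if_neg (by norm_num)]
    simp only [LinearMap.map_add, LinearMap.map_sub, coeff_eulerOp, coeff_C_mul, coeff_mk]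
    push_cast
    linear_combination -h1
  · rw [show k + 1 + 1 = k + 2 from rfl, coeff_X_pow_mul]
    simp only [LinearMap.map_add, LinearMap.map_sub, coeff_eulerOp, coeff_C_mul, coeff_mk]
    push_cast
    linear_combination h k

open PowerSeries in
-- The indicial factor (k - ℓ)(k + ℓ + n - 1) vanishes for no natural k ≠ ℓ, so every coefficient
-- other than that of X^ℓ is determined by the one two steps below.
lemma SolvesODE.eq_zero {n ℓ : ℕ} (hn : 1 ≤ n) {κ : ℝ} {y : ℝ⟦X⟧} (hy : SolvesODE n ℓ κ y)
    (h0 : coeff ℓ y = 0) : y = 0 := by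
  have hc : ∀ k : ℕ, ((k : ℝ) - ℓ) * (k + ℓ + n - 1) * coeff k y = 0 → coeff k y = 0 := by
    intro k hk
    by_cases hkl : k = ℓ
    · rw [hkl, h0]
    · refine (mul_eq_zero.1 hk).resolve_left (mul_ne_zero ?_ ?_)
      · exact sub_ne_zero.2 (by exact_mod_cast hkl)
      · have h1 : (1 : ℝ) ≤ n := by exact_mod_cast hn
        have h2 : (1 : ℝ) ≤ k + ℓ := by exact_mod_cast (show 1 ≤ k + ℓ by omega)
        linarith
  ext k
  rw [map_zero]
  induction k using Nat.strong_induction_on with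
  | _ k ih =>
    apply hc
    have h := congrArg (coeff k) hy
    simp only [LinearMap.map_add, LinearMap.map_sub, coeff_eulerOp, coeff_C_mul, coeff_X_pow_mul'] at h
    have hr : (if 2 ≤ k then ((k - 2 : ℕ) : ℝ) * (((k - 2 : ℕ) : ℝ) * coeff (k - 2) y) +
        (1 - 2 * κ) * (((k - 2 : ℕ) : ℝ) * coeff (k - 2) y) +
        κ * (κ - 1) * coeff (k - 2) y else 0) = 0 := by
      split_ifs with h2
      · rw [ih (k - 2) (by omega)]; ring
      · rfl
    rw [hr] at h
    linear_combination h

open PowerSeries in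
lemma SolvesODE.sub_smul {n ℓ : ℕ} {κ : ℝ} {y z : ℝ⟦X⟧} (hy : SolvesODE n ℓ κ y)
    (hz : SolvesODE n ℓ κ z) (a b : ℝ) : SolvesODE n ℓ κ (a • y - b • z) := by
  unfold SolvesODE at *
  simp only [Derivation.map_sub, Derivation.map_smul]
  simp only [smul_eq_C_mul]
  linear_combination C a * hy - C b * hz

open PowerSeries in
/-- Euler's transformation: multiplication by `(1 - X²)^(n/2+κ)` maps solutions for the exponent
`-n-κ` to solutions for the exponent `κ`. -/
lemma SolvesODE.mul {n ℓ : ℕ} {κ : ℝ} {v w : ℝ⟦X⟧} (hw : SolvesODE n ℓ (-n - κ) w)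
    (hv : (1 - X ^ 2) * eulerOp v = -(C (n + 2 * κ) * X ^ 2 * v)) : SolvesODE n ℓ κ (v * w) := by
  have hv' : (1 - X ^ 2) * eulerOp (eulerOp v) - 2 * X ^ 2 * eulerOp v =
      -(C (n + 2 * κ) * (2 * X ^ 2 * v + X ^ 2 * eulerOp v)) := by
    have := congrArg eulerOp hv
    simp only [Derivation.leibniz, map_sub, map_neg, Derivation.leibniz_pow, eulerOp_X,
      Derivation.map_one_eq_zero, smul_eq_mul, nsmul_eq_mul] at this
    have hC : eulerOp (C ((n : ℝ) + 2 * κ)) = 0 := eulerOp.map_algebraMap _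
    rw [hC] at this
    push_cast at this
    linear_combination this
  unfold SolvesODE at *
  have hne : (1 - X ^ 2 : ℝ⟦X⟧) ≠ 0 := by
    intro h
    have := congrArg (coeff 0) h
    simp at this
  -- `hv` and `hv'` control the Euler derivatives of v only after multiplication by 1 - X².
  refine mul_left_cancel₀ hne ?_
  rw [← sub_eq_zero]
  simp only [Derivation.leibniz, map_add, smul_eq_mul]
  simp only [map_add, map_sub, map_mul, map_neg, map_one, map_ofNat, map_natCast] at *
  linear_combination ((2 - ((n : ℝ⟦X⟧) + 2 * C κ)) * X ^ 2 * w + 2 * (1 - X ^ 2) * eulerOp w +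
    ((n : ℝ⟦X⟧) - 1 - X ^ 2 * (1 - 2 * C κ)) * w) * hv + (1 - X ^ 2) * w * hv' +
    (1 - X ^ 2) * v * hw

open PowerSeries in
/-- The power series of `(1 - x²)^σ`, as the product of those of `(1 - x)^σ` and `(1 + x)^σ`. -/
def oneSubSqPow (σ : ℝ) : ℝ⟦X⟧ := mk (binCoeff σ) * mk fun k => (-1) ^ k * binCoeff σ k

open PowerSeries in
lemma eulerOp_oneSubSqPow (σ : ℝ) :
    (1 - X ^ 2) * eulerOp (oneSubSqPow σ) = -(C (2 * σ) * X ^ 2 * oneSubSqPow σ) := by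
  have h1 : (1 - X) * eulerOp (mk (binCoeff σ)) = -(C σ * X * mk (binCoeff σ)) := by
    ext k
    rw [sub_mul, one_mul, mul_assoc (C σ)]
    cases k with
    | zero => simp [constantCoeff_eulerOp]
    | succ k =>
      simp only [map_sub, map_neg, coeff_succ_X_mul, coeff_C_mul, coeff_eulerOp, coeff_mk]
      push_cast
      linear_combination binCoeff_succ σ k
  have h2 : (1 + X) * eulerOp (mk fun k => (-1) ^ k * binCoeff σ k) =
      C σ * X * mk fun k => (-1) ^ k * binCoeff σ k := by
    ext k
    rw [add_mul, one_mul, mul_assoc (C σ)]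
    cases k with
    | zero => simp [constantCoeff_eulerOp]
    | succ k =>
      simp only [map_add, coeff_succ_X_mul, coeff_C_mul, coeff_eulerOp, coeff_mk, pow_succ]
      push_cast
      linear_combination (-(-1) ^ k) * binCoeff_succ σ k
  rw [oneSubSqPow, Derivation.leibniz, smul_eq_mul, smul_eq_mul, map_mul, map_ofNat]
  linear_combination (1 + X) * (mk fun k => (-1) ^ k * binCoeff σ k) * h1 +
    (1 - X) * mk (binCoeff σ) * h2

open PowerSeries in
/-- The power series `F` converges at `r`, with sum `y`. -/
def HasValue (F : ℝ⟦X⟧) (r y : ℝ) : Prop := HasSum (fun k => coeff k F * r ^ k) y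

open PowerSeries in
lemma HasValue.mul {F G : ℝ⟦X⟧} {r y z : ℝ} (hF : HasValue F r y) (hG : HasValue G r z) :
    HasValue (F * G) r (y * z) := by
  have hf : Summable fun k => ‖coeff k F * r ^ k‖ := hF.summable.norm
  have hg : Summable fun k => ‖coeff k G * r ^ k‖ := hG.summable.norm
  have h1 := (summable_norm_sum_mul_antidiagonal_of_summable_norm hf hg).of_norm.hasSum
  rw [← tsum_mul_tsum_eq_tsum_sum_antidiagonal_of_summable_norm hf hg, hF.tsum_eq, hG.tsum_eq] at h1
  refine h1.congr_fun fun k => ?_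
  rw [coeff_mul, Finset.sum_mul]
  refine Finset.sum_congr rfl fun ij hij => ?_
  rw [← Finset.HasAntidiagonal.mem_antidiagonal.1 hij, pow_add]; ring

lemma hasValue_oneSubSqPow (σ : ℝ) {r : ℝ} (hr : |r| < 1) :
    HasValue (oneSubSqPow σ) r ((1 - r ^ 2) ^ σ) := by
  have h1 : HasValue (PowerSeries.mk (binCoeff σ)) r ((1 - r) ^ σ) := by
    simpa [HasValue] using hasSum_binCoeff σ hr
  have h2 : HasValue (PowerSeries.mk fun k => (-1) ^ k * binCoeff σ k) r ((1 + r) ^ σ) := by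
    have := hasSum_binCoeff σ (x := -r) (by rwa [abs_neg])
    rw [sub_neg_eq_add] at this
    simp only [HasValue, PowerSeries.coeff_mk]
    refine this.congr_fun fun k => ?_
    rw [neg_pow r]; ring
  have h := h1.mul h2
  rw [← Real.mul_rpow (by linarith [abs_lt.1 hr]) (by linarith [abs_lt.1 hr])] at h
  rwa [show 1 - r ^ 2 = (1 - r) * (1 + r) by ring]

/-! ### The intertwining relation between the kernels -/

lemma abs_inner_le {n : ℕ} (ζ : Eu n) (ω : Sph n) : |inner ℝ ζ (ω : Eu n)| ≤ ‖ζ‖ := by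
  simpa using abs_real_inner_le_norm ζ (ω : Eu n)

lemma one_sub_inner_pos {n : ℕ} {ζ : Eu n} (hζ : ‖ζ‖ < 1) (ω : Sph n) :
    0 < 1 - inner ℝ ζ (ω : Eu n) := by
  linarith [le_abs_self (inner ℝ ζ (ω : Eu n)), abs_inner_le ζ ω]

lemma continuous_one_sub_inner_rpow {n : ℕ} {ζ : Eu n} (hζ : ‖ζ‖ < 1) (κ : ℝ) :
    Continuous fun ω : Sph n => (1 - inner ℝ ζ (ω : Eu n)) ^ κ :=
  Continuous.rpow_const (by fun_prop) fun ω => Or.inl (one_sub_inner_pos hζ ω).ne'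

lemma hasSum_integral_kernel {n : ℕ} (f : C(Sph n, ℝ)) {e : Eu n} (he : ‖e‖ = 1) (κ : ℝ) {r : ℝ}
    (hr : |r| < 1) :
    HasSum (fun k => binCoeff κ k * (∫ ω : Sph n, f ω * inner ℝ e (ω : Eu n) ^ k ∂(surf n)) * r ^ k)
      (∫ ω : Sph n, f ω * (1 - inner ℝ (r • e) (ω : Eu n)) ^ κ ∂(surf n)) := by
  have hx : ∀ ω : Sph n, |inner ℝ e (ω : Eu n)| ≤ 1 := fun ω => (abs_inner_le e ω).trans_eq he
  have hsum : Summable fun k => ‖f‖ * (|binCoeff κ k| * |r| ^ k) := by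
    have := (hasSum_binCoeff κ hr).summable.abs.mul_left ‖f‖
    simpa [abs_mul] using this
  have key := hasSum_integral_of_dominated_convergence (μ := surf n)
    (F := fun (k : ℕ) (ω : Sph n) => f ω * (binCoeff κ k * (r * inner ℝ e (ω : Eu n)) ^ k))
    (f := fun ω => f ω * (1 - inner ℝ (r • e) (ω : Eu n)) ^ κ)
    (fun k _ => ‖f‖ * (|binCoeff κ k| * |r| ^ k))
    (fun k => (by fun_prop : Continuous _).aestronglyMeasurable)
    (fun k => Filter.Eventually.of_forall fun ω => by
      rw [norm_mul, norm_mul, norm_pow, norm_mul]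
      simp only [Real.norm_eq_abs (binCoeff κ k), Real.norm_eq_abs r,
        Real.norm_eq_abs (inner ℝ e _)]
      refine mul_le_mul (f.norm_coe_le_norm ω) ?_ (by positivity) (norm_nonneg _)
      gcongr
      exact mul_le_of_le_one_right (abs_nonneg _) (hx ω))
    (Filter.Eventually.of_forall fun ω => hsum)
    (integrable_const _)
    (Filter.Eventually.of_forall fun ω => by
      have h : |inner ℝ (r • e) (ω : Eu n)| < 1 := by
        rw [inner_smul_left, abs_mul]
        exact lt_of_le_of_lt (mul_le_of_le_one_right (abs_nonneg _) (hx ω)) (by simpa using hr)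
      have := (hasSum_binCoeff κ h).mul_left (f ω)
      simpa [inner_smul_left] using this)
  refine key.congr_fun fun k => ?_
  rw [← integral_const_mul, ← integral_mul_const]
  congr 1; ext ω; rw [mul_pow]; ring

/-- The intertwining relation between the kernels `(1 - ζ·ω)^κ` and `(1 - ζ·ω)^(-n-κ)`, tested
against a spherical harmonic of degree `ℓ`. -/
theorem integral_harmonic_kernel {n ℓ : ℕ} (hn : 1 ≤ n) {A : MvPolynomial (Fin (n + 1)) ℝ}
    (hA : A.IsHomogeneous ℓ) (hA0 : polyLaplacian n A = 0) (κ : ℝ) {ζ : Eu n} (hζ : ‖ζ‖ < 1) :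
    (∏ j ∈ Finset.range ℓ, ((j : ℝ) + n + κ)) *
        ∫ ω : Sph n, restrictPoly n A ω * (1 - inner ℝ ζ (ω : Eu n)) ^ κ ∂(surf n) =
      (∏ j ∈ Finset.range ℓ, ((j : ℝ) - κ)) * ((1 - ‖ζ‖ ^ 2) ^ ((n : ℝ) / 2 + κ) *
        ∫ ω : Sph n, restrictPoly n A ω * (1 - inner ℝ ζ (ω : Eu n)) ^ (-n - κ) ∂(surf n)) := by
  obtain ⟨e, he⟩ := exists_smul_sphere ζ
  have he1 : ‖(e : Eu n)‖ = 1 := by simp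
  set r := ‖ζ‖ with hr
  have hr1 : |r| < 1 := by rwa [hr, abs_norm]
  rw [he]
  -- The moment recurrence combined with two steps of the binomial recurrence; the vanishing moments
  -- below degree ℓ, and the parity case ℓ = 0, k = 1, give the two initial conditions.
  have hY : ∀ κ : ℝ, SolvesODE n ℓ κ (PowerSeries.mk fun k => binCoeff κ k * moment A e k) := by
    intro κ
    refine solvesODE_mk ?_ ?_ fun k => ?_
    · rcases Nat.eq_zero_or_pos ℓ with rfl | hl
      · simp
      · simp [moment_eq_zero_of_lt hn hA hA0 e hl]
    · rcases lt_trichotomy ℓ 1 with hl | rfl | hl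
      · obtain rfl : ℓ = 0 := by omega
        simp [moment_one_eq_zero hn hA]
      · simp
      · simp [moment_eq_zero_of_lt hn hA hA0 e hl]
    · have h1 := moment_recurrence hn hA hA0 he1 k
      have h2 := binCoeff_succ κ k
      have h3 := binCoeff_succ κ (k + 1)
      push_cast at h3
      have hk : ((k : ℝ) + 2) * (k + 1) ≠ 0 := by positivity
      refine mul_left_cancel₀ hk ?_
      linear_combination (k + 2) * (k + 1) * binCoeff κ (k + 2) * h1 +
        (k + 2) * (k + 1) * moment A e k * (k + 1) * h3 + 
        (k + 2) * (k + 1) * moment A e k * (k + 1 - κ) * h2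
  have hval : ∀ κ : ℝ, HasValue (PowerSeries.mk fun k => binCoeff κ k * moment A e k) r
      (∫ ω : Sph n, restrictPoly n A ω * (1 - inner ℝ (r • (e : Eu n)) (ω : Eu n)) ^ κ ∂(surf n)) := by
    intro κ
    have := hasSum_integral_kernel (restrictPoly n A) he1 κ hr1
    simpa only [HasValue, PowerSeries.coeff_mk, moment_eq] using this
  set V := oneSubSqPow ((n : ℝ) / 2 + κ) with hV
  have hVW := (hY (-n - κ)).mul (v := V) (by
    rw [hV, eulerOp_oneSubSqPow, show 2 * ((n : ℝ) / 2 + κ) = n + 2 * κ by ring])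
  set a := ∏ j ∈ Finset.range ℓ, ((j : ℝ) + n + κ) with ha
  set b := ∏ j ∈ Finset.range ℓ, ((j : ℝ) - κ) with hb
  -- Both series solve the equation for κ, so only their coefficients at X^ℓ have to be compared.
  -- Moments below ℓ vanish, so the product contributes just the constant term 1 of V times the
  -- coefficient of X^ℓ in the other factor.
  have hzero := ((hY κ).sub_smul hVW a b).eq_zero hn (by
    rw [map_sub, map_smul, map_smul, PowerSeries.coeff_mk, PowerSeries.coeff_mul,
      Finset.sum_eq_single (0, ℓ)]
    · have hV0 : PowerSeries.coeff 0 V = 1 := by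
        simp [hV, oneSubSqPow, binCoeff_zero]
      have h1 := factorial_mul_binCoeff κ ℓ
      have h2 := factorial_mul_binCoeff (-n - κ) ℓ
      rw [show (∏ j ∈ Finset.range ℓ, ((j : ℝ) - (-n - κ))) = a from
        Finset.prod_congr rfl fun j _ => by ring] at h2
      rw [hV0, PowerSeries.coeff_mk, ← h2, hb, ← h1]
      simp only [smul_eq_mul]; ring
    · rintro ⟨i, j⟩ hij hne
      have hij' : i + j = ℓ := Finset.HasAntidiagonal.mem_antidiagonal.1 hij
      have hj : j < ℓ := by
        rcases Nat.eq_zero_or_pos i with rfl | hi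
        · exact absurd (by simpa using hij') (fun h : j = ℓ => hne (by rw [h]))
        · omega
      simp [moment_eq_zero_of_lt hn hA hA0 e hj]
    · intro h; simp at h)
  have h1 := (hval κ).mul_left a
  have h2 := ((hasValue_oneSubSqPow ((n : ℝ) / 2 + κ) hr1).mul (hval (-n - κ))).mul_left b
  refine h1.unique (h2.congr_fun fun k => ?_)
  have := congrArg (PowerSeries.coeff k) hzero
  rw [map_sub, map_smul, map_smul, map_zero, smul_eq_mul, smul_eq_mul] at this
  linear_combination r ^ k * this

/-! ### Signs and growth of the eigenvalues -/

/-- The admissible exponents: `s - n/2 ∈ (0,1) ∪ (1,2)`. -/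
def Admissible (n : ℕ) (s : ℝ) : Prop :=
  s - n / 2 ∈ Set.Ioo (0 : ℝ) 1 ∪ Set.Ioo (1 : ℝ) 2

lemma Admissible.pos {n : ℕ} {s : ℝ} (hs : Admissible n s) : 0 < s - n / 2 := by
  rcases hs with h | h <;> linarith [h.1]

lemma Admissible.lt_two {n : ℕ} {s : ℝ} (hs : Admissible n s) : s - n / 2 < 2 := by
  rcases hs with h | h <;> linarith [h.2]

lemma Admissible.natCast_sub_ne_zero {n : ℕ} {s : ℝ} (hs : Admissible n s) (ℓ : ℕ) :
    (ℓ : ℝ) - (s - n / 2) ≠ 0 := by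
  intro h
  have hℓ : (ℓ : ℝ) = s - n / 2 := by linarith
  rcases hs with hs | hs <;> rw [← hℓ] at hs <;> obtain ⟨h1, h2⟩ := hs
  · norm_cast at h1 h2; omega
  · norm_cast at h1 h2; omega

/-- The functional equation of Γ in numerator and denominator; it needs ℓ ≠ s - n/2, which is why s
- n/2 = 1 is excluded. -/
lemma α_succ {n : ℕ} {s : ℝ} (hs : Admissible n s) (ℓ : ℕ) :
    α n s (ℓ + 1) * (ℓ - (s - n / 2)) = α n s ℓ * (ℓ + n + (s - n / 2)) := by
  have hβ := hs.pos
  have h1 := hs.natCast_sub_ne_zero ℓ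
  have h2 : (ℓ : ℝ) + n + (s - n / 2) ≠ 0 := by positivity
  have e1 := Real.Gamma_add_one h1
  have e2 := Real.Gamma_add_one h2
  unfold α
  rw [show (((ℓ + 1 : ℕ) : ℝ) + n / 2 + s) = ℓ + n + (s - n / 2) + 1 by push_cast; ring,
    show (((ℓ + 1 : ℕ) : ℝ) + n / 2 - s) = ℓ - (s - n / 2) + 1 by push_cast; ring,
    show (ℓ : ℝ) + n / 2 + s = ℓ + n + (s - n / 2) by ring,
    show (ℓ : ℝ) + n / 2 - s = ℓ - (s - n / 2) by ring, e1, e2, div_mul_eq_mul_div,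
    mul_comm _ (Real.Gamma ((ℓ : ℝ) - (s - n / 2))), mul_div_mul_right _ _ h1]
  ring

/-- These are the two products of `integral_harmonic_kernel`, so the eigenvalue exactly absorbs the
ℓ-dependence of the intertwining relation. -/
lemma α_mul_prod {n : ℕ} {s : ℝ} (hs : Admissible n s) (ℓ : ℕ) :
    α n s ℓ * ∏ j ∈ Finset.range ℓ, ((j : ℝ) - (s - n / 2)) =
      α n s 0 * ∏ j ∈ Finset.range ℓ, ((j : ℝ) + n + (s - n / 2)) := by
  induction ℓ with
  | zero => simp
  | succ ℓ ih =>
    rw [Finset.prod_range_succ, Finset.prod_range_succ, ← mul_assoc, ← mul_assoc, ← ih]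
    linear_combination (∏ j ∈ Finset.range ℓ, ((j : ℝ) - (s - n / 2))) * α_succ hs ℓ

lemma α_pos_of_two_le {n : ℕ} {s : ℝ} (hs : Admissible n s) {ℓ : ℕ} (hℓ : 2 ≤ ℓ) :
    0 < α n s ℓ := by
  have h2 : (2 : ℝ) ≤ ℓ := by exact_mod_cast hℓ
  have := hs.pos
  have := hs.lt_two
  have hn : (0 : ℝ) ≤ n := n.cast_nonneg
  exact div_pos (Real.Gamma_pos_of_pos (by linarith)) (Real.Gamma_pos_of_pos (by linarith))

/-- The factor 1 - (s - n/2) treats both ranges of s at once. The sign is carried down from the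
positive eigenvalue at ℓ = 2 by the recurrence, here to ℓ = 1 and in `α_zero_mul` to ℓ = 0. -/
lemma α_one_mul {n : ℕ} {s : ℝ} (hs : Admissible n s) : 0 < α n s 1 * (1 - (s - n / 2)) := by
  have h := α_succ hs 1
  have h2 := α_pos_of_two_le hs le_rfl
  have hβ := hs.pos
  have h1 : (1 : ℝ) - (s - n / 2) ≠ 0 := by simpa using hs.natCast_sub_ne_zero 1
  have hp : (0 : ℝ) < 1 + n + (s - n / 2) := by positivity
  push_cast at h
  have h3 : α n s 1 * (1 - (s - n / 2)) * (1 + n + (s - n / 2)) =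
      α n s 2 * (1 - (s - n / 2)) ^ 2 := by
    linear_combination (-(1 - (s - n / 2))) * h
  have h4 : 0 < α n s 2 * (1 - (s - n / 2)) ^ 2 := by positivity
  exact pos_of_mul_pos_left (h3 ▸ h4) hp.le

lemma α_zero_mul {n : ℕ} {s : ℝ} (hs : Admissible n s) : α n s 0 * (1 - (s - n / 2)) < 0 := by
  have h := α_succ hs 0
  have h1 := α_one_mul hs
  have hβ := hs.pos
  have hp : (0 : ℝ) < n + (s - n / 2) := by positivity
  norm_num at h
  have : (α n s 0 * (1 - (s - n / 2))) * (n + (s - n / 2)) < 0 := by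
    rw [show (α n s 0 * (1 - (s - n / 2))) * (n + (s - n / 2)) =
      -((s - n / 2) * (α n s 1 * (1 - (s - n / 2)))) by
        linear_combination (-(1 - (s - n / 2))) * h]
    exact neg_neg_of_pos (mul_pos hβ h1)
  exact neg_of_mul_neg_left this hp.le

lemma α_ne_zero {n : ℕ} {s : ℝ} (hs : Admissible n s) (ℓ : ℕ) : α n s ℓ ≠ 0 := by
  rcases ℓ with _ | _ | ℓ
  · intro h; simpa [h] using α_zero_mul hs
  · intro h; simpa [h] using α_one_mul hs
  · exact (α_pos_of_two_le hs (by omega)).ne'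

lemma Admissible.one_le_two_mul {n : ℕ} (hn : 1 ≤ n) {s : ℝ} (hs : Admissible n s) :
    1 ≤ 2 * s := by
  have h1 : (1 : ℝ) ≤ n := by exact_mod_cast hn
  linarith [hs.pos]

/-- The ratio of successive eigenvalues is 1 + 2s/(ℓ - β), and Bernoulli's inequality bounds it by
((ℓ + 1 - β)/(ℓ - β))^(2s); the product telescopes. -/
lemma exists_abs_α_le {n : ℕ} (hn : 1 ≤ n) {s : ℝ} (hs : Admissible n s) :
    ∃ K : ℝ, 0 < K ∧ ∀ ℓ : ℕ, |α n s ℓ| ≤ K * (1 + (ℓ : ℝ)) ^ (2 * s) := by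
  set β := s - n / 2 with hβ
  have h0 := hs.pos
  have h2 := hs.lt_two
  rw [← hβ] at h0 h2
  have hp := hs.one_le_two_mul hn
  -- Chosen to give equality at ℓ = 2, where the induction starts.
  set K := α n s 2 / (2 - β) ^ (2 * s) with hK
  have hKpos : 0 < K := div_pos (α_pos_of_two_le hs le_rfl) (Real.rpow_pos_of_pos (by linarith) _)
  have key : ∀ ℓ : ℕ, 2 ≤ ℓ → α n s ℓ ≤ K * ((ℓ : ℝ) - β) ^ (2 * s) := by
    intro ℓ hℓ
    induction ℓ, hℓ using Nat.le_induction with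
    | base =>
      rw [hK, Nat.cast_ofNat, div_mul_cancel₀]
      exact (Real.rpow_pos_of_pos (by linarith) _).ne'
    | succ ℓ hℓ ih =>
      have hℓ' : (2 : ℝ) ≤ ℓ := by exact_mod_cast hℓ
      have hx : 0 < (ℓ : ℝ) - β := by linarith
      have h := α_succ hs ℓ
      rw [← hβ] at h
      have hB := one_add_mul_self_le_rpow_one_add (s := 1 / ((ℓ : ℝ) - β))
        (by linarith [one_div_pos.2 hx]) hp
      have e1 : α n s (ℓ + 1) = α n s ℓ * (1 + 2 * s * (1 / ((ℓ : ℝ) - β))) := by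
        rw [eq_div_of_mul_eq hx.ne' h]
        field_simp
        rw [hβ]; ring
      rw [e1]
      calc α n s ℓ * (1 + 2 * s * (1 / ((ℓ : ℝ) - β)))
          ≤ (K * ((ℓ : ℝ) - β) ^ (2 * s)) * (1 + 1 / ((ℓ : ℝ) - β)) ^ (2 * s) := by
            refine mul_le_mul ih hB ?_ (by positivity)
            have : 0 < s := by linarith
            positivity
        _ = K * (((ℓ + 1 : ℕ) : ℝ) - β) ^ (2 * s) := by
            rw [mul_assoc, ← Real.mul_rpow hx.le (by positivity)]
            congr 2
            push_cast
            field_simp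
            ring
  refine ⟨K + |α n s 0| + |α n s 1|, by positivity, fun ℓ => ?_⟩
  have hge : 1 ≤ (1 + (ℓ : ℝ)) ^ (2 * s) := Real.one_le_rpow (by linarith [ℓ.cast_nonneg (α := ℝ)])
    (by linarith)
  have a0 := abs_nonneg (α n s 0)
  have a1 := abs_nonneg (α n s 1)
  rcases ℓ with _ | _ | ℓ
  · nlinarith
  · nlinarith
  · have hk := key (ℓ + 2) (by omega)
    have hpos := α_pos_of_two_le hs (show 2 ≤ ℓ + 2 by omega)
    rw [show ℓ + 1 + 1 = ℓ + 2 from rfl] at hge ⊢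
    rw [abs_of_pos hpos]
    have : (((ℓ + 2 : ℕ) : ℝ) - β) ^ (2 * s) ≤ (1 + ((ℓ + 2 : ℕ) : ℝ)) ^ (2 * s) := by
      refine Real.rpow_le_rpow ?_ (by linarith) (by linarith)
      push_cast
      linarith [ℓ.cast_nonneg (α := ℝ)]
    nlinarith

/-- Bernoulli's inequality for the inverse ratio 1 - 2s/x with x = ℓ + n + β, bounded by ((x -
1)/x)^(2s), telescopes likewise. -/
lemma exists_le_abs_α {n : ℕ} (hn : 1 ≤ n) {s : ℝ} (hs : Admissible n s) :
    ∃ K : ℝ, 0 < K ∧ ∀ ℓ : ℕ, K * (1 + (ℓ : ℝ)) ^ (2 * s) ≤ |α n s ℓ| := by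
  set β := s - n / 2 with hβ
  have h0 := hs.pos
  have h2 := hs.lt_two
  rw [← hβ] at h0 h2
  have hn' : (1 : ℝ) ≤ n := by exact_mod_cast hn
  have hp := hs.one_le_two_mul hn
  set K := α n s 2 / (2 + n + β - 1) ^ (2 * s) with hK
  have hKpos : 0 < K := div_pos (α_pos_of_two_le hs le_rfl) (Real.rpow_pos_of_pos (by linarith) _)
  have key : ∀ ℓ : ℕ, 2 ≤ ℓ → K * ((ℓ : ℝ) + n + β - 1) ^ (2 * s) ≤ α n s ℓ := by
    intro ℓ hℓ
    induction ℓ, hℓ using Nat.le_induction with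
    | base =>
      rw [hK, Nat.cast_ofNat, div_mul_cancel₀]
      exact (Real.rpow_pos_of_pos (by linarith) _).ne'
    | succ ℓ hℓ ih =>
      have hℓ' : (2 : ℝ) ≤ ℓ := by exact_mod_cast hℓ
      have hy : 0 < (ℓ : ℝ) - β := by linarith
      set x := (ℓ : ℝ) + n + β with hx
      have hx1 : 1 < x := by linarith
      have h := α_succ hs ℓ
      rw [← hβ, ← hx] at h
      have hB := one_add_mul_self_le_rpow_one_add (s := -(1 / x))
        (by
          have := (div_le_one (by linarith : (0 : ℝ) < x)).2 hx1.le
          linarith) hp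
      have hxs : 1 + 2 * s * -(1 / x) = ((ℓ : ℝ) - β) / x := by
        field_simp
        rw [hx, hβ]; ring
      have hxx : (x - 1) ^ (2 * s) = x ^ (2 * s) * (1 + -(1 / x)) ^ (2 * s) := by
        rw [← Real.mul_rpow (by linarith)]
        · congr 1; field_simp; ring
        · have := (div_le_one (by linarith : (0 : ℝ) < x)).2 hx1.le
          linarith
      rw [hxs] at hB
      rw [hxx] at ih
      rw [show ((ℓ + 1 : ℕ) : ℝ) + n + β - 1 = x by push_cast; rw [hx]; ring,
        eq_div_of_mul_eq hy.ne' h, le_div_iff₀ hy]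
      have hxp : 0 < x ^ (2 * s) := Real.rpow_pos_of_pos (by linarith) _
      calc K * x ^ (2 * s) * (ℓ - β) = K * (x ^ (2 * s) * (((ℓ : ℝ) - β) / x)) * x := by
            field_simp
        _ ≤ K * (x ^ (2 * s) * (1 + -(1 / x)) ^ (2 * s)) * x := by gcongr
        _ ≤ α n s ℓ * x := by gcongr
  have h2s : (0 : ℝ) < 2 ^ (2 * s) := by positivity
  -- The three entries serve ℓ ≥ 2, ℓ = 0 and ℓ = 1. The power of 2 comes from (1 + ℓ)/2 ≤ ℓ + n + β
  -- - 1 in the first and from 1 + ℓ = 2 in the last.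
  set c := min (K / 2 ^ (2 * s)) (min |α n s 0| (|α n s 1| / 2 ^ (2 * s))) with hc
  refine ⟨c, lt_min (by positivity) (lt_min (abs_pos.2 (α_ne_zero hs 0))
    (div_pos (abs_pos.2 (α_ne_zero hs 1)) h2s)), fun ℓ => ?_⟩
  rcases ℓ with _ | _ | ℓ
  · have : c ≤ |α n s 0| := (min_le_right _ _).trans (min_le_left _ _)
    simpa using this
  · have : c ≤ |α n s 1| / 2 ^ (2 * s) := (min_le_right _ _).trans (min_le_right _ _)
    rw [le_div_iff₀ h2s] at this
    norm_num
    exact this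
  · have hk := key (ℓ + 2) (by omega)
    have hpos := α_pos_of_two_le hs (show 2 ≤ ℓ + 2 by omega)
    rw [show ℓ + 1 + 1 = ℓ + 2 from rfl, abs_of_pos hpos]
    refine le_trans ?_ hk
    have hcK : c ≤ K / 2 ^ (2 * s) := min_le_left _ _
    have hl := ℓ.cast_nonneg (α := ℝ)
    calc c * (1 + ((ℓ + 2 : ℕ) : ℝ)) ^ (2 * s)
        ≤ K / 2 ^ (2 * s) * (1 + ((ℓ + 2 : ℕ) : ℝ)) ^ (2 * s) := by gcongr
      _ = K * ((1 + ((ℓ + 2 : ℕ) : ℝ)) / 2) ^ (2 * s) := by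
          rw [Real.div_rpow (by positivity) (by norm_num)]; ring
      _ ≤ K * (((ℓ + 2 : ℕ) : ℝ) + n + β - 1) ^ (2 * s) := by
          refine mul_le_mul_of_nonneg_left (Real.rpow_le_rpow (by positivity) ?_ (by linarith)) hKpos.le
          push_cast
          linarith

/-! ### The Sobolev space and the quadratic form -/

section Hs

variable {n : ℕ} {s : ℝ}

lemma Hs_smul {u : L2 n} (hu : u ∈ Hs n s) (c : ℝ) : c • u ∈ Hs n s := by
  have := Summable.mul_left (c ^ 2) hu
  refine this.congr fun ℓ => ?_
  rw [map_smul, norm_smul, mul_pow, Real.norm_eq_abs, sq_abs]; ring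

lemma Hs_add {u v : L2 n} (hu : u ∈ Hs n s) (hv : v ∈ Hs n s) : u + v ∈ Hs n s := by
  refine Summable.of_nonneg_of_le (fun ℓ => by positivity) (fun ℓ => ?_)
    ((Summable.add hu hv).mul_left 2)
  rw [map_add, ← mul_add, mul_left_comm]
  gcongr
  have h1 := norm_add_le (P n ℓ u) (P n ℓ v)
  have h2 := norm_nonneg (P n ℓ u + P n ℓ v)
  nlinarith [sq_nonneg (‖P n ℓ u‖ - ‖P n ℓ v‖)]

lemma Hs_sub {u v : L2 n} (hu : u ∈ Hs n s) (hv : v ∈ Hs n s) : u - v ∈ Hs n s := by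
  have := Hs_add hu (Hs_smul hv (-1))
  rwa [neg_one_smul, ← sub_eq_add_neg] at this

lemma summable_aBilin (hn : 1 ≤ n) (hs : Admissible n s) {u v : L2 n} (hu : u ∈ Hs n s)
    (hv : v ∈ Hs n s) : Summable fun ℓ : ℕ => α n s ℓ * inner ℝ (P n ℓ u) (P n ℓ v) := by
  obtain ⟨K, hK, hα⟩ := exists_abs_α_le hn hs
  refine Summable.of_norm_bounded ((Summable.add hu hv).mul_left K) fun ℓ => ?_
  rw [norm_mul, Real.norm_eq_abs, ← mul_add, ← mul_assoc]
  refine mul_le_mul (hα ℓ) ?_ (norm_nonneg _) (by positivity)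
  have := norm_inner_le_norm (𝕜 := ℝ) (P n ℓ u) (P n ℓ v)
  nlinarith [sq_nonneg (‖P n ℓ u‖ - ‖P n ℓ v‖), sq_nonneg (‖P n ℓ u‖), sq_nonneg (‖P n ℓ v‖)]

lemma aQuad_eq_aBilin (u : L2 n) : aQuad n s u = aBilin n s u u := by
  simp [aQuad, aBilin]

lemma aBilin_comm (u v : L2 n) : aBilin n s u v = aBilin n s v u := by
  rw [aBilin, aBilin]
  congr 1; ext ℓ
  rw [real_inner_comm]

lemma aBilin_smul_left (c : ℝ) (u v : L2 n) : aBilin n s (c • u) v = c * aBilin n s u v := by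
  rw [aBilin, aBilin, ← tsum_mul_left]
  congr 1; ext ℓ
  rw [map_smul, real_inner_smul_left]; ring

lemma aBilin_smul_right (c : ℝ) (u v : L2 n) : aBilin n s u (c • v) = c * aBilin n s u v := by
  rw [aBilin_comm, aBilin_smul_left, aBilin_comm]

lemma aBilin_add_left (hn : 1 ≤ n) (hs : Admissible n s) {u v w : L2 n} (hu : u ∈ Hs n s)
    (hv : v ∈ Hs n s) (hw : w ∈ Hs n s) :
    aBilin n s (u + v) w = aBilin n s u w + aBilin n s v w := by
  rw [aBilin, aBilin, aBilin, ← (summable_aBilin hn hs hu hw).tsum_add (summable_aBilin hn hs hv hw)]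
  congr 1; ext ℓ
  rw [map_add, inner_add_left]; ring

lemma aBilin_add_right (hn : 1 ≤ n) (hs : Admissible n s) {u v w : L2 n} (hu : u ∈ Hs n s)
    (hv : v ∈ Hs n s) (hw : w ∈ Hs n s) :
    aBilin n s w (u + v) = aBilin n s w u + aBilin n s w v := by
  rw [aBilin_comm, aBilin_add_left hn hs hu hv hw, aBilin_comm u, aBilin_comm v]

lemma aQuad_add (hn : 1 ≤ n) (hs : Admissible n s) {u v : L2 n} (hu : u ∈ Hs n s)
    (hv : v ∈ Hs n s) :
    aQuad n s (u + v) = aQuad n s u + 2 * aBilin n s u v + aQuad n s v := by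
  simp only [aQuad_eq_aBilin]
  rw [aBilin_add_left hn hs hu hv (Hs_add hu hv), aBilin_add_right hn hs hu hv hu,
    aBilin_add_right hn hs hu hv hv, aBilin_comm v u]
  ring

lemma aQuad_smul (c : ℝ) (u : L2 n) : aQuad n s (c • u) = c ^ 2 * aQuad n s u := by
  rw [aQuad_eq_aBilin, aBilin_smul_left, aBilin_smul_right, aQuad_eq_aBilin]; ring

lemma exists_P_ne_zero (hn : 1 ≤ n) {u : L2 n} (hu : u ≠ 0) : ∃ ℓ, P n ℓ u ≠ 0 := by
  by_contra! h
  have := hasSum_inner_P hn u u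
  simp only [h, inner_zero_left] at this
  exact hu (inner_self_eq_zero.1 (this.unique hasSum_zero))

/-- Positivity of the quadratic form off the spherical harmonics of negative eigenvalue. -/
lemma aQuad_pos (hn : 1 ≤ n) (hs : Admissible n s) {u : L2 n} (hu : u ∈ Hs n s) (hu0 : u ≠ 0)
    {ℓ₀ : ℕ} (hℓ₀ : ∀ ℓ, ℓ ≠ ℓ₀ → 0 < α n s ℓ) (hP : P n ℓ₀ u = 0) : 0 < aQuad n s u := by
  have hsum : Summable fun ℓ : ℕ => α n s ℓ * ‖P n ℓ u‖ ^ 2 := by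
    simpa using summable_aBilin hn hs hu hu
  obtain ⟨ℓ, hℓ⟩ := exists_P_ne_zero hn hu0
  have hne : ℓ ≠ ℓ₀ := fun h => hℓ (h ▸ hP)
  refine hsum.tsum_pos (fun j => ?_) ℓ (mul_pos (hℓ₀ ℓ hne) (by positivity))
  by_cases hj : j = ℓ₀
  · simp [hj, hP]
  · exact mul_nonneg (hℓ₀ j hj).le (by positivity)

/-- `ξ` is the image of `η` under the operator with eigenvalue `α_{2s}(ℓ)` on the spherical
harmonics of degree `ℓ`. -/
def IsImage (n : ℕ) (s : ℝ) (η ξ : L2 n) : Prop := ∀ ℓ, α n s ℓ • P n ℓ η = P n ℓ ξ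

lemma IsImage.add {η η' ξ ξ' : L2 n} (h : IsImage n s η ξ) (h' : IsImage n s η' ξ') :
    IsImage n s (η + η') (ξ + ξ') := fun ℓ => by
  rw [map_add, map_add, smul_add, h, h']

lemma IsImage.smul {η ξ : L2 n} (h : IsImage n s η ξ) (c : ℝ) :
    IsImage n s (c • η) (c • ξ) := fun ℓ => by
  rw [map_smul, map_smul, smul_comm, h]

/-- Since |α_{2s}(ℓ)| is at least a multiple of (1 + ℓ)^(2s), an L² image forces even H^(2s)
regularity. This is how kernels and tangent vectors are seen to lie in H^s. -/
lemma IsImage.mem_Hs (hn : 1 ≤ n) (hs : Admissible n s) {η ξ : L2 n} (h : IsImage n s η ξ) :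
    η ∈ Hs n s := by
  obtain ⟨K, hK, hα⟩ := exists_le_abs_α hn hs
  have hsum : Summable fun ℓ => ‖P n ℓ ξ‖ ^ 2 := by
    simpa using (hasSum_inner_P hn ξ ξ).summable
  refine Summable.of_nonneg_of_le (fun ℓ => by positivity) (fun ℓ => ?_) (hsum.mul_left (K ^ 2)⁻¹)
  have hge : 1 ≤ (1 + (ℓ : ℝ)) ^ (2 * s) := Real.one_le_rpow
    (by linarith [ℓ.cast_nonneg (α := ℝ)]) (by linarith [hs.one_le_two_mul hn])
  rw [← h ℓ, norm_smul, Real.norm_eq_abs, mul_pow, ← mul_assoc]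
  refine mul_le_mul_of_nonneg_right ?_ (by positivity)
  rw [le_inv_mul_iff₀ (by positivity)]
  set y := (1 + (ℓ : ℝ)) ^ (2 * s)
  calc K ^ 2 * y ≤ K ^ 2 * (y * y) := by
        gcongr; nlinarith
    _ = (K * y) ^ 2 := by ring
    _ ≤ |α n s ℓ| ^ 2 := by gcongr; exact hα ℓ

/-- Parseval's identity; it turns the form into integrals that can be computed. -/
lemma IsImage.aBilin_eq (hn : 1 ≤ n) {η ξ : L2 n} (h : IsImage n s η ξ) (u : L2 n) :
    aBilin n s u η = inner ℝ u ξ := by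
  rw [← (hasSum_inner_P hn u ξ).tsum_eq, aBilin]
  congr 1; ext ℓ
  rw [← h ℓ, real_inner_smul_right]

end Hs

/-! ### Kernels and their dependence on ζ -/

variable {n : ℕ}

/-- The kernel `ω ↦ (1 - ζ·ω)^κ`. -/
def kern (κ : ℝ) {ζ : Eu n} (hζ : ‖ζ‖ < 1) : C(Sph n, ℝ) :=
  ⟨fun ω => (1 - inner ℝ ζ (ω : Eu n)) ^ κ, continuous_one_sub_inner_rpow hζ κ⟩

lemma kern_apply (κ : ℝ) {ζ : Eu n} (hζ : ‖ζ‖ < 1) (ω : Sph n) :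
    kern κ hζ ω = (1 - inner ℝ ζ (ω : Eu n)) ^ κ := rfl

lemma kern_pos (κ : ℝ) {ζ : Eu n} (hζ : ‖ζ‖ < 1) (ω : Sph n) : 0 < kern κ hζ ω :=
  Real.rpow_pos_of_pos (one_sub_inner_pos hζ ω) κ

lemma kern_mul_kern (κ κ' : ℝ) {ζ : Eu n} (hζ : ‖ζ‖ < 1) :
    kern κ hζ * kern κ' hζ = kern (κ + κ') hζ := by
  ext ω
  exact (Real.rpow_add (one_sub_inner_pos hζ ω) κ κ').symm

/-- The function `ω ↦ e·ω` on the sphere. -/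
def lin (e : Eu n) : C(Sph n, ℝ) := restrictPoly n (linPoly e)

lemma lin_apply (e : Eu n) (ω : Sph n) : lin e ω = inner ℝ e (ω : Eu n) :=
  restrictPoly_linPoly e ω

lemma kern_one {ζ : Eu n} (hζ : ‖ζ‖ < 1) : kern 1 hζ = 1 - lin ζ := by
  ext ω
  simp [kern_apply, lin_apply]

lemma kern_zero {ζ : Eu n} (hζ : ‖ζ‖ < 1) : kern 0 hζ = 1 := by
  ext ω
  simp [kern_apply]

/-- A bound valid for exponents of either sign, used for dominated convergence. -/
lemma rpow_le_add_of_mem_Icc {m M x : ℝ} (hm : 0 < m) (hx : x ∈ Set.Icc m M) (p : ℝ) :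
    x ^ p ≤ m ^ p + M ^ p := by
  have hx0 : 0 < x := hm.trans_le hx.1
  have hM : 0 < M := hx0.trans_le hx.2
  have h1 := Real.rpow_nonneg hm.le p
  have h2 := Real.rpow_nonneg hM.le p
  rcases le_total 0 p with hp | hp
  · linarith [Real.rpow_le_rpow hx0.le hx.2 hp]
  · linarith [Real.rpow_le_rpow_of_nonpos hm hx.1 hp]

lemma one_sub_inner_mem_Icc {ζ : Eu n} {R : ℝ} (hR : R < 1) (hζ : ‖ζ‖ ≤ R) (ω : Sph n) :
    1 - inner ℝ ζ (ω : Eu n) ∈ Set.Icc (1 - R) 2 := by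
  have h := abs_le.1 ((abs_inner_le ζ ω).trans hζ)
  constructor <;> linarith [h.1, h.2]

lemma hasDerivAt_integral_kernel (f : C(Sph n, ℝ)) (κ : ℝ) {ζ : Eu n} (hζ : ‖ζ‖ < 1) (e : Eu n) :
    HasDerivAt (fun t : ℝ => ∫ ω : Sph n, f ω * (1 - inner ℝ (ζ + t • e) (ω : Eu n)) ^ κ ∂(surf n))
      (-κ * ∫ ω, f ω * (lin e * kern (κ - 1) hζ) ω ∂(surf n)) 0 := by
  -- A radius strictly between ‖ζ‖ and 1 keeps 1 - ζ·ω above 1 - R for all nearby parameters.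
  set R := (1 + ‖ζ‖) / 2 with hR
  have hR1 : R < 1 := by linarith
  set U : Set ℝ := {t | ‖ζ + t • e‖ < R} with hU
  have hUo : IsOpen U := isOpen_lt (by fun_prop) continuous_const
  have h0 : (0 : ℝ) ∈ U := by simp only [hU, Set.mem_ofPred_eq, zero_smul, add_zero]; linarith
  have hUball : ∀ t ∈ U, ‖ζ + t • e‖ < 1 := fun t ht => lt_trans ht hR1
  have hlin : ∀ (t : ℝ) (ω : Sph n), HasDerivAt
      (fun t : ℝ => 1 - inner ℝ (ζ + t • e) (ω : Eu n)) (-inner ℝ e (ω : Eu n)) t := by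
    intro t ω
    have : (fun t : ℝ => 1 - inner ℝ (ζ + t • e) (ω : Eu n)) =
        fun t => 1 - (inner ℝ ζ (ω : Eu n) + t * inner ℝ e (ω : Eu n)) := by
      ext t; rw [inner_add_left, real_inner_smul_left]
    rw [this]
    simpa using (((hasDerivAt_id t).mul_const (inner ℝ e (ω : Eu n))).const_add
      (inner ℝ ζ (ω : Eu n))).const_sub 1
  have key := (hasDerivAt_integral_of_dominated_loc_of_deriv_le (μ := surf n) (x₀ := (0 : ℝ)) (s := U)
    (F := fun t ω => f ω * (1 - inner ℝ (ζ + t • e) (ω : Eu n)) ^ κ)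
    (F' := fun t ω => f ω * (-inner ℝ e (ω : Eu n) * κ *
      (1 - inner ℝ (ζ + t • e) (ω : Eu n)) ^ (κ - 1)))
    (bound := fun _ => ‖f‖ * (‖e‖ * |κ| * ((1 - R) ^ (κ - 1) + 2 ^ (κ - 1))))
    (hUo.mem_nhds h0) ?_ ?_ ?_ ?_ (integrable_const _) ?_).2
  · convert! key using 1
    rw [← integral_const_mul]
    congr 1; ext ω
    simp only [ContinuousMap.mul_apply, lin_apply, kern_apply, zero_smul, add_zero]
    ring
  · filter_upwards [hUo.mem_nhds h0] with t ht
    exact (f.continuous.mul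
      (continuous_one_sub_inner_rpow (hUball t ht) κ)).aestronglyMeasurable
  · simp only [zero_smul, add_zero]
    exact continuous_integrable (f.continuous.mul (continuous_one_sub_inner_rpow hζ κ))
  · simp only [zero_smul, add_zero]
    exact (f.continuous.mul (Continuous.mul (by fun_prop)
      (continuous_one_sub_inner_rpow hζ (κ - 1)))).aestronglyMeasurable
  · refine Filter.Eventually.of_forall fun ω t ht => ?_
    have hmem := one_sub_inner_mem_Icc hR1 (le_of_lt ht) ω
    have hpos : 0 < 1 - inner ℝ (ζ + t • e) (ω : Eu n) := lt_of_lt_of_le (by linarith) hmem.1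
    have hb := rpow_le_add_of_mem_Icc (by linarith) hmem (κ - 1)
    rw [norm_mul, norm_mul, norm_mul, norm_neg, Real.norm_of_nonneg (Real.rpow_nonneg hpos.le _),
      Real.norm_eq_abs (inner ℝ e _), Real.norm_eq_abs κ]
    have h1 := f.norm_coe_le_norm ω
    have h2 := abs_inner_le e ω
    have h3 := Real.rpow_nonneg hpos.le (κ - 1)
    gcongr
  · refine Filter.Eventually.of_forall fun ω t ht => ?_
    have hpos := one_sub_inner_pos (hUball t ht) ω
    exact ((hlin t ω).rpow_const (Or.inl hpos.ne')).const_mul (f ω)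

lemma continuousOn_integral_kernel (f : C(Sph n, ℝ)) (κ : ℝ) {R : ℝ} (hR : R < 1) :
    ContinuousOn (fun ζ : Eu n => ∫ ω : Sph n, f ω * (1 - inner ℝ ζ (ω : Eu n)) ^ κ ∂(surf n))
      (Metric.closedBall 0 R) := by
  refine continuousOn_of_dominated (bound := fun _ => ‖f‖ * ((1 - R) ^ κ + 2 ^ κ)) ?_ ?_
    (integrable_const _) ?_
  · intro ζ hζ
    have hζ' : ‖ζ‖ < 1 := lt_of_le_of_lt (by simpa using hζ) hR
    exact (f.continuous.mul (continuous_one_sub_inner_rpow hζ' κ)).aestronglyMeasurable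
  · intro ζ hζ
    refine Filter.Eventually.of_forall fun ω => ?_
    have hmem := one_sub_inner_mem_Icc hR (by simpa using hζ) ω
    have hpos : 0 < 1 - inner ℝ ζ (ω : Eu n) := lt_of_lt_of_le (by linarith) hmem.1
    have hb := rpow_le_add_of_mem_Icc (by linarith) hmem κ
    rw [norm_mul, Real.norm_of_nonneg (Real.rpow_nonneg hpos.le _)]
    have h1 := f.norm_coe_le_norm ω
    gcongr
  · refine Filter.Eventually.of_forall fun ω => ?_
    refine continuousOn_const.mul (ContinuousOn.rpow_const (by fun_prop) fun ζ hζ => Or.inl ?_)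
    exact (one_sub_inner_pos (lt_of_le_of_lt (by simpa using hζ) hR) ω).ne'

lemma one_sub_norm_sq_pos {ζ : Eu n} (hζ : ‖ζ‖ < 1) : 0 < 1 - ‖ζ‖ ^ 2 := by
  nlinarith [norm_nonneg ζ]

lemma hasDerivAt_one_sub_norm_sq_rpow {ζ : Eu n} (hζ : ‖ζ‖ < 1) (e : Eu n) (σ : ℝ) :
    HasDerivAt (fun t : ℝ => (1 - ‖ζ + t • e‖ ^ 2) ^ σ)
      (-(2 * σ * inner ℝ ζ e * (1 - ‖ζ‖ ^ 2) ^ (σ - 1))) 0 := by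
  have h1 : HasDerivAt (fun t : ℝ => ‖ζ + t • e‖ ^ 2) (2 * inner ℝ ζ e) 0 := by
    simpa using (((hasDerivAt_id (0 : ℝ)).smul_const e).const_add ζ).norm_sq
  have h2 := (h1.const_sub 1).rpow_const (p := σ) (Or.inl (by
    simpa using (one_sub_norm_sq_pos hζ).ne'))
  refine h2.congr_deriv ?_
  simp only [zero_smul, add_zero]
  ring

/-! ### The operator on kernels and their derivatives -/

lemma integral_kernel_intertwine {ℓ : ℕ} (hn : 1 ≤ n) {s : ℝ} (hs : Admissible n s)
    {A : MvPolynomial (Fin (n + 1)) ℝ} (hA : A.IsHomogeneous ℓ) (hA0 : polyLaplacian n A = 0)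
    {ζ : Eu n} (hζ : ‖ζ‖ < 1) :
    α n s ℓ * ∫ ω : Sph n, restrictPoly n A ω * (1 - inner ℝ ζ (ω : Eu n)) ^ (s - n / 2) ∂(surf n) =
      α n s 0 * ((1 - ‖ζ‖ ^ 2) ^ s *
        ∫ ω : Sph n, restrictPoly n A ω * (1 - inner ℝ ζ (ω : Eu n)) ^ (-n - (s - n / 2))
          ∂(surf n)) := by
  have h := integral_harmonic_kernel hn hA hA0 (s - n / 2) hζ
  rw [show (n : ℝ) / 2 + (s - n / 2) = s by ring] at h
  have hβ := hs.pos
  have hne : ∏ j ∈ Finset.range ℓ, ((j : ℝ) + n + (s - n / 2)) ≠ 0 :=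
    Finset.prod_ne_zero_iff.2 fun j _ => by positivity
  refine mul_left_cancel₀ hne ?_
  have := α_mul_prod hs ℓ
  rw [mul_left_comm, h, ← mul_assoc, this]
  ring

lemma isImage_toL2_iff {s : ℝ} (f g : C(Sph n, ℝ)) :
    IsImage n s (toL2 n f) (toL2 n g) ↔ ∀ ℓ (A : MvPolynomial (Fin (n + 1)) ℝ), A.IsHomogeneous ℓ →
      polyLaplacian n A = 0 → α n s ℓ * ∫ ω, restrictPoly n A ω * f ω ∂(surf n) =
        ∫ ω, restrictPoly n A ω * g ω ∂(surf n) := by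
  refine forall_congr' fun ℓ => ?_
  rw [← map_smul, P_eq_iff]
  refine forall_congr' fun A => forall_congr' fun hA => forall_congr' fun hA0 => ?_
  rw [real_inner_smul_right, inner_toL2, inner_toL2]

theorem isImage_kern (hn : 1 ≤ n) {s : ℝ} (hs : Admissible n s) {ζ : Eu n} (hζ : ‖ζ‖ < 1) :
    IsImage n s (toL2 n (kern (s - n / 2) hζ))
      (toL2 n ((α n s 0 * (1 - ‖ζ‖ ^ 2) ^ s) • kern (-n - (s - n / 2)) hζ)) := by
  rw [isImage_toL2_iff]
  intro ℓ A hA hA0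
  have := integral_kernel_intertwine hn hs hA hA0 hζ
  simp only [kern_apply, ContinuousMap.smul_apply, smul_eq_mul]
  rw [this, ← mul_assoc, ← integral_const_mul]
  congr 1; ext ω; ring

/-- The image of `ω ↦ (e·ω) (1 - ζ·ω)^(s - n/2 - 1)`. -/
def linKernImage (s : ℝ) {ζ : Eu n} (hζ : ‖ζ‖ < 1) (e : Eu n) : C(Sph n, ℝ) :=
  (α n s 0 / (s - n / 2) * (1 - ‖ζ‖ ^ 2) ^ (s - 1)) •
    ((2 * s * inner ℝ ζ e) • kern (-n - (s - n / 2)) hζ -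
      ((n + (s - n / 2)) * (1 - ‖ζ‖ ^ 2)) • (lin e * kern (-n - (s - n / 2) - 1) hζ))

theorem isImage_lin_mul_kern (hn : 1 ≤ n) {s : ℝ} (hs : Admissible n s) {ζ : Eu n} (hζ : ‖ζ‖ < 1)
    (e : Eu n) :
    IsImage n s (toL2 n (lin e * kern (s - n / 2 - 1) hζ)) (toL2 n (linKernImage s hζ e)) := by
  rw [isImage_toL2_iff]
  intro ℓ A hA hA0
  set f := restrictPoly n A
  have hβ := hs.pos
  set β := s - n / 2 with hβdef
  -- Both sides of the intertwining relation are differentiated along ζ + t e; the derivative of the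
  -- left kernel is -β times the function wanted.
  have h1 := (hasDerivAt_integral_kernel f β hζ e).const_mul (α n s ℓ)
  have h2 := ((hasDerivAt_one_sub_norm_sq_rpow hζ e s).mul
    (hasDerivAt_integral_kernel f (-n - β) hζ e)).const_mul (α n s 0)
  have hU : ∀ᶠ t : ℝ in 𝓝 0, ‖ζ + t • e‖ < 1 :=
    (isOpen_lt (by fun_prop : Continuous fun t : ℝ => ‖ζ + t • e‖) continuous_const).mem_nhds
      (by simpa using hζ)
  have heq := h1.unique (h2.congr_of_eventuallyEq (by
    filter_upwards [hU] with t ht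
    exact integral_kernel_intertwine hn hs hA hA0 ht))
  simp only [zero_smul, add_zero] at heq
  have hq : (1 - ‖ζ‖ ^ 2) ^ s = (1 - ‖ζ‖ ^ 2) ^ (s - 1) * (1 - ‖ζ‖ ^ 2) := by
    rw [← Real.rpow_add_one (one_sub_norm_sq_pos hζ).ne', sub_add_cancel]
  rw [hq] at heq
  have hI : ∫ ω, f ω * linKernImage s hζ e ω ∂(surf n) =
      α n s 0 / β * (1 - ‖ζ‖ ^ 2) ^ (s - 1) * (2 * s * inner ℝ ζ e *
        ∫ ω, f ω * kern (-n - β) hζ ω ∂(surf n) - (n + β) * (1 - ‖ζ‖ ^ 2) *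
          ∫ ω, f ω * (lin e * kern (-n - β - 1) hζ) ω ∂(surf n)) := by
    rw [← integral_const_mul, ← integral_const_mul, ← integral_sub, ← integral_const_mul]
    · congr 1; ext ω
      simp only [linKernImage, ContinuousMap.smul_apply, ContinuousMap.sub_apply, smul_eq_mul,
        ← hβdef]
      ring
    · exact continuous_integrable (by fun_prop)
    · exact continuous_integrable (by fun_prop)
  rw [hI]
  have hne : β ≠ 0 := hβ.ne'
  refine mul_left_cancel₀ (neg_ne_zero.2 hne) ?_
  field_simp
  change _ * (_ * ∫ ω, f ω * (lin e * kern (β - 1) hζ) ω ∂(surf n)) = 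
    _ * (_ * (∫ ω, f ω * kern (-n - β) hζ ω ∂(surf n)) + _) at heq
  linear_combination heq

/-! ### Tangent spaces and their orthogonal complements -/

lemma lin_add (e e' : Eu n) : lin (e + e') = lin e + lin e' := by
  ext ω; simp [lin_apply, inner_add_left]

lemma lin_smul (c : ℝ) (e : Eu n) : lin (c • e) = c • lin e := by
  ext ω; simp [lin_apply, inner_smul_left]

lemma mem_optimizers_iff {s : ℝ} {h : C(Sph n, ℝ)} :
    h ∈ optimizers n s ↔ ∃ c : ℝ, 0 < c ∧ ∃ (ζ : Eu n) (hζ : ‖ζ‖ < 1),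
      h = c • kern (s - n / 2) hζ := by
  have hβ : (2 * s - n) / 2 = s - n / 2 := by ring
  constructor
  · rintro ⟨c, hc, ζ, hζ, h1⟩
    refine ⟨c, hc, ζ, hζ, ?_⟩
    ext ω
    rw [h1, hβ]; rfl
  · rintro ⟨c, hc, ζ, hζ, rfl⟩
    refine ⟨c, hc, ζ, hζ, fun ω => ?_⟩
    rw [hβ]; rfl

section tangent

variable {s c : ℝ} {ζ : Eu n}

lemma kern_mem_tangentSpace (hc : 0 < c) (hζ : ‖ζ‖ < 1) :
    kern (s - n / 2) hζ ∈ tangentSpace n s (c • kern (s - n / 2) hζ) := by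
  refine ⟨fun t => (c + t) • kern (s - n / 2) hζ, ?_, by simp, fun ω => ?_⟩
  · filter_upwards [lt_mem_nhds (show -c < 0 by linarith)] with t ht
    exact mem_optimizers_iff.2 ⟨c + t, by linarith, ζ, hζ, rfl⟩
  · simpa using ((hasDerivAt_id (0 : ℝ)).const_add c).mul_const (kern (s - n / 2) hζ ω)

lemma lin_mul_kern_mem_tangentSpace (hs : Admissible n s) (hc : 0 < c) (hζ : ‖ζ‖ < 1) (e : Eu n) :
    lin e * kern (s - n / 2 - 1) hζ ∈ tangentSpace n s (c • kern (s - n / 2) hζ) := by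
  have hβ := hs.pos
  set β := s - n / 2 with hβdef
  -- The scaling cancels the factor -cβ that appears on differentiating c (1 - ζ·ω)^β in ζ.
  set v : Eu n := (-(1 / (c * β))) • e with hv
  have hU : ∀ᶠ t : ℝ in 𝓝 0, ‖ζ + t • v‖ < 1 :=
    (isOpen_lt (by fun_prop : Continuous fun t : ℝ => ‖ζ + t • v‖) continuous_const).mem_nhds
      (by simpa using hζ)
  -- Outside the ball the path takes the irrelevant value 0; only t near 0 matters.
  refine ⟨fun t => if ht : ‖ζ + t • v‖ < 1 then c • kern β ht else 0, ?_, ?_, fun ω => ?_⟩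
  · filter_upwards [hU] with t ht
    rw [dif_pos ht]
    exact mem_optimizers_iff.2 ⟨c, hc, _, ht, rfl⟩
  · simp only [zero_smul, add_zero, dif_pos hζ]
  · have h1 : HasDerivAt (fun t : ℝ => 1 - (inner ℝ ζ (ω : Eu n) + t * inner ℝ v (ω : Eu n)))
        (-inner ℝ v (ω : Eu n)) 0 := by
      simpa using (((hasDerivAt_id (0 : ℝ)).mul_const (inner ℝ v (ω : Eu n))).const_add
        (inner ℝ ζ (ω : Eu n))).const_sub 1
    have h2 := (h1.rpow_const (p := β) (Or.inl (by
      simpa using (one_sub_inner_pos hζ ω).ne'))).const_mul c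
    refine (h2.congr_deriv ?_).congr_of_eventuallyEq ?_
    · simp only [ContinuousMap.mul_apply, lin_apply, kern_apply, hv, real_inner_smul_left, zero_mul,
        add_zero]
      field_simp
    · filter_upwards [hU] with t ht
      rw [dif_pos ht, ContinuousMap.smul_apply, kern_apply, inner_add_left, real_inner_smul_left,
        smul_eq_mul]

/-- The `i`-th standard basis vector, as a point of the sphere. -/
def basisPt (i : Fin (n + 1)) : Sph n := ⟨EuclideanSpace.single i 1, by simp⟩

lemma inner_basisPt (x : Eu n) (i : Fin (n + 1)) : inner ℝ x (basisPt i : Eu n) = x i := by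
  simp [basisPt, EuclideanSpace.inner_single_right]

/-- The power 1/β of any element of 𝓜 is an affine function on the sphere. Hence so is the velocity
of γ^(1/β), and the chain rule returns to η. No differentiability of the parameters c and ζ along
the path is needed. -/
lemma exists_eq_of_mem_tangentSpace (hs : Admissible n s) (hc : 0 < c) (hζ : ‖ζ‖ < 1)
    {η : C(Sph n, ℝ)} (hη : η ∈ tangentSpace n s (c • kern (s - n / 2) hζ)) :
    ∃ (a : ℝ) (e : Eu n), η = a • kern (s - n / 2) hζ + lin e * kern (s - n / 2 - 1) hζ := by
  have hβ := hs.pos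
  obtain ⟨γ, hγ, hγ0, hd⟩ := hη
  set β := s - n / 2 with hβdef
  set h := c • kern β hζ with hh
  have hhpos : ∀ ω, 0 < h ω := fun ω => mul_pos hc (kern_pos β hζ ω)
  set θ : Sph n → ℝ := fun ω => η ω * (1 / β) * (h ω) ^ (1 / β - 1) with hθ
  have hY : ∀ ω, HasDerivAt (fun t => (γ t ω) ^ (1 / β)) (θ ω) 0 := by
    intro ω
    have := (hd ω).rpow_const (p := 1 / β) (Or.inl (by rw [hγ0]; exact (hhpos ω).ne'))
    rwa [hγ0] at this
  -- An affine function is a fixed linear combination of its values at the points ± basis vectors,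
  -- so the interpolation identity can be differentiated pointwise.
  have haff : ∀ ω : Sph n, θ ω = (θ (basisPt 0) + θ (-basisPt 0)) / 2 +
      ∑ i, (ω : Eu n) i * ((θ (basisPt i) - θ (-basisPt i)) / 2) := by
    intro ω
    have h1 : HasDerivAt (fun t => ((γ t (basisPt 0)) ^ (1 / β) + (γ t (-basisPt 0)) ^ (1 / β)) / 2 +
        ∑ i, (ω : Eu n) i * (((γ t (basisPt i)) ^ (1 / β) - (γ t (-basisPt i)) ^ (1 / β)) / 2))
        ((θ (basisPt 0) + θ (-basisPt 0)) / 2 +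
          ∑ i, (ω : Eu n) i * ((θ (basisPt i) - θ (-basisPt i)) / 2)) 0 := by
      refine HasDerivAt.add (((hY _).add (hY _)).div_const 2) (HasDerivAt.fun_sum fun i _ => ?_)
      exact (((hY _).sub (hY _)).div_const 2).const_mul _
    refine (hY ω).unique (h1.congr_of_eventuallyEq ?_)
    filter_upwards [hγ] with t ht
    obtain ⟨c', hc', ζ', hζ', ht'⟩ := mem_optimizers_iff.1 ht
    have hval : ∀ ω : Sph n, (γ t ω) ^ (1 / β) = c' ^ (1 / β) * (1 - inner ℝ ζ' (ω : Eu n)) := by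
      intro ω
      have hp := one_sub_inner_pos hζ' ω
      rw [ht', ContinuousMap.smul_apply, kern_apply, smul_eq_mul,
        Real.mul_rpow hc'.le (Real.rpow_nonneg hp.le _), ← Real.rpow_mul hp.le,
        mul_one_div_cancel hβ.ne', Real.rpow_one]
    simp only [hval, Metric.sphere, coe_neg_sphere, inner_neg_right, inner_basisPt]
    have hin : inner ℝ ζ' (ω : Eu n) = ∑ i, (ω : Eu n) i * ζ' i := by
      simp [PiLp.inner_apply]
    rw [hin, mul_sub, Finset.mul_sum]
    have : ∀ i, (ω : Eu n) i * ((c' ^ (1 / β) * (1 - ζ' i) - c' ^ (1 / β) * (1 - -ζ' i)) / 2) =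
        -(c' ^ (1 / β) * ((ω : Eu n) i * ζ' i)) := fun i => by ring
    rw [Finset.sum_congr rfl fun i _ => this i, Finset.sum_neg_distrib]
    ring
  set k := (θ (basisPt 0) + θ (-basisPt 0)) / 2
  set b : Eu n := WithLp.toLp 2 fun i => (θ (basisPt i) - θ (-basisPt i)) / 2 with hb
  have haff' : ∀ ω : Sph n, θ ω = k * (1 - inner ℝ ζ (ω : Eu n)) +
      inner ℝ (b + k • ζ) (ω : Eu n) := by
    intro ω
    have : inner ℝ b (ω : Eu n) = ∑ i, (ω : Eu n) i * ((θ (basisPt i) - θ (-basisPt i)) / 2) := by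
      simp [PiLp.inner_apply, hb]
    rw [haff ω, inner_add_left, real_inner_smul_left, this]; ring
  have hη' : ∀ ω, η ω = β * c ^ (1 - 1 / β) * θ ω * kern (β - 1) hζ ω := by
    intro ω
    have e1 : (h ω) ^ (1 / β - 1) * (c ^ (1 - 1 / β) * kern (β - 1) hζ ω) = 1 := by
      have hp := one_sub_inner_pos hζ ω
      have e2 : c ^ (1 - 1 / β) * kern (β - 1) hζ ω = (h ω) ^ (1 - 1 / β) := by
        rw [hh, ContinuousMap.smul_apply, kern_apply, kern_apply, smul_eq_mul,
          Real.mul_rpow hc.le (Real.rpow_nonneg hp.le _), ← Real.rpow_mul hp.le]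
        congr 2; field_simp
      rw [e2, ← Real.rpow_add (hhpos ω)]; norm_num
    have e3 : β * (1 / β) = 1 := mul_one_div_cancel hβ.ne'
    calc η ω = η ω * (β * (1 / β)) * ((h ω) ^ (1 / β - 1) * (c ^ (1 - 1 / β) * kern (β - 1) hζ ω)) := by
          rw [e1, e3]; ring
      _ = _ := by simp only [hθ]; ring
  refine ⟨β * c ^ (1 - 1 / β) * k, (β * c ^ (1 - 1 / β)) • (b + k • ζ), ?_⟩
  ext ω
  have hk : kern β hζ ω = (1 - inner ℝ ζ (ω : Eu n)) * kern (β - 1) hζ ω := by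
    rw [kern_apply, kern_apply, ← Real.rpow_one_add' (one_sub_inner_pos hζ ω).le (by linarith)]
    ring_nf
  rw [hη', haff']
  simp only [ContinuousMap.add_apply, ContinuousMap.smul_apply, ContinuousMap.mul_apply, lin_apply,
    smul_eq_mul, real_inner_smul_left, hk]
  ring

lemma α_zero_mul_rpow_ne_zero (hs : Admissible n s) (hζ : ‖ζ‖ < 1) (σ : ℝ) :
    α n s 0 * (1 - ‖ζ‖ ^ 2) ^ σ ≠ 0 :=
  mul_ne_zero (α_ne_zero hs 0) (Real.rpow_pos_of_pos (one_sub_norm_sq_pos hζ) _).ne'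

lemma aBilin_kern (hn : 1 ≤ n) (hs : Admissible n s) (hζ : ‖ζ‖ < 1) (ρ : L2 n) :
    aBilin n s ρ (toL2 n (kern (s - n / 2) hζ)) =
      α n s 0 * (1 - ‖ζ‖ ^ 2) ^ s * inner ℝ ρ (toL2 n (kern (-n - (s - n / 2)) hζ)) := by
  rw [(isImage_kern hn hs hζ).aBilin_eq hn, map_smul, real_inner_smul_right]

lemma aBilin_lin_mul_kern (hn : 1 ≤ n) (hs : Admissible n s) (hζ : ‖ζ‖ < 1) (e : Eu n) (ρ : L2 n) :
    aBilin n s ρ (toL2 n (lin e * kern (s - n / 2 - 1) hζ)) =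
      α n s 0 / (s - n / 2) * (1 - ‖ζ‖ ^ 2) ^ (s - 1) *
        (2 * s * inner ℝ ζ e * inner ℝ ρ (toL2 n (kern (-n - (s - n / 2)) hζ)) -
          (n + (s - n / 2)) * (1 - ‖ζ‖ ^ 2) *
            inner ℝ ρ (toL2 n (lin e * kern (-n - (s - n / 2) - 1) hζ))) := by
  rw [(isImage_lin_mul_kern hn hs hζ e).aBilin_eq hn, linKernImage]
  simp only [map_smul, map_sub, real_inner_smul_right, inner_sub_right]

/-- The orthogonality conditions, in terms of the `L²` inner product. -/
lemma mem_tangentPerp_iff (hn : 1 ≤ n) (hs : Admissible n s) (hc : 0 < c) (hζ : ‖ζ‖ < 1)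
    (ρ : L2 n) :
    ρ ∈ tangentPerp n s (c • kern (s - n / 2) hζ) ↔ ρ ∈ Hs n s ∧
      inner ℝ ρ (toL2 n (kern (-n - (s - n / 2)) hζ)) = 0 ∧
        ∀ e, inner ℝ ρ (toL2 n (lin e * kern (-n - (s - n / 2) - 1) hζ)) = 0 := by
  have hβ := hs.pos
  have hA := α_zero_mul_rpow_ne_zero hs hζ
  constructor
  · rintro ⟨hρ, h⟩
    have h1 := h _ (kern_mem_tangentSpace hc hζ)
    rw [aBilin_kern hn hs] at h1
    have h1 := (mul_eq_zero.1 h1).resolve_left (hA s)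
    refine ⟨hρ, h1, fun e => ?_⟩
    have h2 := h _ (lin_mul_kern_mem_tangentSpace hs hc hζ e)
    rw [aBilin_lin_mul_kern hn hs, h1, mul_zero, zero_sub] at h2
    have hne : α n s 0 / (s - n / 2) * (1 - ‖ζ‖ ^ 2) ^ (s - 1) ≠ 0 := by
      rw [div_mul_eq_mul_div]; exact div_ne_zero (hA _) hβ.ne'
    have h3 := neg_eq_zero.1 ((mul_eq_zero.1 h2).resolve_left hne)
    exact (mul_eq_zero.1 h3).resolve_left
      (mul_ne_zero (by positivity) (one_sub_norm_sq_pos hζ).ne')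
  · rintro ⟨hρ, h1, h2⟩
    refine ⟨hρ, fun φ hφ => ?_⟩
    obtain ⟨a, e, rfl⟩ := exists_eq_of_mem_tangentSpace hs hc hζ hφ
    rw [map_add, map_smul, aBilin_add_right hn hs
      (Hs_smul ((isImage_kern hn hs hζ).mem_Hs hn hs) a)
      ((isImage_lin_mul_kern hn hs hζ e).mem_Hs hn hs) hρ, aBilin_smul_right,
      aBilin_kern hn hs, aBilin_lin_mul_kern hn hs, h1, h2]
    ring

end tangent

/-! ### Positivity on the complement of a tangent space -/

/-- If `ρ` is orthogonal to a negative definite space of maximal dimension, then the quadratic form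
is positive at `ρ`. -/
lemma aQuad_pos_of_orthogonal (hn : 1 ≤ n) {s : ℝ} (hs : Admissible n s) {V W : Type*}
    [AddCommGroup V] [Module ℝ V] [FiniteDimensional ℝ V]
    [AddCommGroup W] [Module ℝ W] [FiniteDimensional ℝ W]
    (hVW : Module.finrank ℝ W ≤ Module.finrank ℝ V) (τ : V →ₗ[ℝ] L2 n) (Φ : L2 n →ₗ[ℝ] W)
    {ℓ₀ : ℕ} (hℓ₀ : ∀ ℓ, ℓ ≠ ℓ₀ → 0 < α n s ℓ) (hΦ : ∀ u, Φ u = 0 → P n ℓ₀ u = 0)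
    (hτH : ∀ v, τ v ∈ Hs n s) (hτ : ∀ v, v ≠ 0 → aQuad n s (τ v) < 0)
    {ρ : L2 n} (hρ : ρ ∈ Hs n s) (hρ0 : ρ ≠ 0) (hort : ∀ v, aBilin n s ρ (τ v) = 0) :
    0 < aQuad n s ρ := by
  let T : ℝ × V →ₗ[ℝ] W := Φ ∘ₗ ((LinearMap.toSpanSingleton ℝ (L2 n) ρ).coprod τ)
  -- The source has dimension 1 + dim V > dim W, so some nontrivial x ρ + τ v has no component of
  -- degree ℓ₀, and the form is nonnegative there.
  have hker : LinearMap.ker T ≠ ⊥ := LinearMap.ker_ne_bot_of_finrank_lt (by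
    rw [Module.finrank_prod, Module.finrank_self]; omega)
  obtain ⟨⟨x, v⟩, hxv, hne⟩ := Submodule.exists_mem_ne_zero_of_ne_bot hker
  have hP : P n ℓ₀ (x • ρ + τ v) = 0 := hΦ _ (by simpa [T] using hxv)
  have hH : x • ρ + τ v ∈ Hs n s := Hs_add (Hs_smul hρ x) (hτH v)
  have hexp : aQuad n s (x • ρ + τ v) = x ^ 2 * aQuad n s ρ + aQuad n s (τ v) := by
    rw [aQuad_add hn hs (Hs_smul hρ x) (hτH v), aQuad_smul, aBilin_smul_left, hort]; ring
  have hnonneg : 0 ≤ aQuad n s (x • ρ + τ v) := by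
    by_cases h0 : x • ρ + τ v = 0
    · rw [h0]; simp [aQuad]
    · exact (aQuad_pos hn hs hH h0 hℓ₀ hP).le
  by_cases hv : v = 0
  · subst hv
    have hx : x ≠ 0 := fun h => hne (by simp [h])
    have hP' : P n ℓ₀ ρ = 0 := by
      rw [map_zero, add_zero, map_smul] at hP
      exact (smul_eq_zero.1 hP).resolve_left hx
    exact aQuad_pos hn hs hρ hρ0 hℓ₀ hP'
  · have h1 := hτ v hv
    rw [hexp] at hnonneg
    have h2 : 0 < x ^ 2 * aQuad n s ρ := by linarith
    exact pos_of_mul_pos_right h2 (sq_nonneg x)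

lemma P_zero_eq_zero {u : L2 n} (h : inner ℝ (toL2 n (1 : C(Sph n, ℝ))) u = 0) : P n 0 u = 0 := by
  rw [← map_zero (P n 0), P_eq_iff]
  intro A hA _
  rw [MvPolynomial.totalDegree_eq_zero_iff_eq_C.1
    ((MvPolynomial.totalDegree_zero_iff_isHomogeneous (p := A)).2 hA)]
  have : restrictPoly n (MvPolynomial.C (MvPolynomial.coeff 0 A)) =
      MvPolynomial.coeff 0 A • (1 : C(Sph n, ℝ)) := by
    ext ω; simp [restrictPoly_apply, evalE]
  rw [this, map_smul, real_inner_smul_left, h]; simp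

lemma P_one_eq_zero {u : L2 n}
    (h : ∀ i, inner ℝ (toL2 n (lin (EuclideanSpace.single i (1 : ℝ)))) u = 0) : P n 1 u = 0 := by
  rw [← map_zero (P n 1), P_eq_iff]
  intro A hA _
  have hA' : A = ∑ i, MvPolynomial.coeff 0 (MvPolynomial.pderiv i A) • MvPolynomial.X i := by
    have := hA.sum_X_mul_pderiv
    rw [one_smul] at this
    conv_lhs => rw [← this]
    refine Finset.sum_congr rfl fun i _ => ?_
    have hi : (MvPolynomial.pderiv i A).IsHomogeneous 0 := hA.pderiv
    conv_lhs => rw [MvPolynomial.totalDegree_eq_zero_iff_eq_C.1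
      ((MvPolynomial.totalDegree_zero_iff_isHomogeneous (p := MvPolynomial.pderiv i A)).2 hi)]
    rw [MvPolynomial.smul_eq_C_mul, mul_comm]
  have hX : ∀ i, restrictPoly n (MvPolynomial.X i) = lin (EuclideanSpace.single i (1 : ℝ)) := by
    intro i; ext ω
    simp [restrictPoly_apply, evalE, lin_apply, EuclideanSpace.inner_single_left]
  rw [hA', map_sum, map_sum, sum_inner, inner_zero_right]
  refine Finset.sum_eq_zero fun i _ => ?_
  rw [map_smul, map_smul, hX, real_inner_smul_left, h, mul_zero]

lemma aQuad_kern (hn : 1 ≤ n) {s : ℝ} (hs : Admissible n s) {ζ : Eu n} (hζ : ‖ζ‖ < 1) :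
    aQuad n s (toL2 n (kern (s - n / 2) hζ)) =
      α n s 0 * (1 - ‖ζ‖ ^ 2) ^ s * ∫ ω, kern (-n) hζ ω ∂(surf n) := by
  rw [aQuad_eq_aBilin, aBilin_kern hn hs, inner_toL2]
  congr 2
  ext ω
  rw [← ContinuousMap.mul_apply, kern_mul_kern]
  congr 2; ring

lemma integral_kern_pos (κ : ℝ) {ζ : Eu n} (hζ : ‖ζ‖ < 1) : 0 < ∫ ω, kern κ hζ ω ∂(surf n) :=
  integral_pos_of_nonneg_of_ne (kern κ hζ).continuous (fun ω => (kern_pos κ hζ ω).le)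
    (kern_pos κ hζ (Classical.arbitrary _)).ne'

section negative

variable {s : ℝ} {ζ : Eu n}

/-- The coefficient of `1 - ζ·ω` in the projection of `e·ω`, orthogonally to it in the weighted
space with density `(1 - ζ·ω)^(-n-2)`. -/
def projCoeff (hζ : ‖ζ‖ < 1) (e : Eu n) : ℝ :=
  inner ℝ (toL2 n (lin e)) (toL2 n (kern (-n - 1) hζ)) / ∫ ω, kern (-n) hζ ω ∂(surf n)

/-- The affine function `e·ω - k (1 - ζ·ω)` with `k` such that it is orthogonal to `1 - ζ·ω`
with respect to the density `(1 - ζ·ω)^(-n-2)`. -/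
def affineFun (hζ : ‖ζ‖ < 1) (e : Eu n) : C(Sph n, ℝ) := lin e - projCoeff hζ e • kern 1 hζ

lemma integral_affineFun_mul_kern (hζ : ‖ζ‖ < 1) (e : Eu n) :
    ∫ ω, affineFun hζ e ω * kern (-n - 1) hζ ω ∂(surf n) = 0 := by
  rw [← inner_toL2, affineFun, map_sub, map_smul, inner_sub_left, real_inner_smul_left, projCoeff,
    inner_toL2 (kern 1 hζ)]
  have : ∀ ω, kern 1 hζ ω * kern (-n - 1) hζ ω = kern (-n) hζ ω := fun ω => by
    rw [← ContinuousMap.mul_apply, kern_mul_kern]; congr 2; ring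
  simp only [this]
  rw [div_mul_cancel₀ _ (integral_kern_pos _ hζ).ne', sub_self]

lemma exists_affineFun_ne_zero (hζ : ‖ζ‖ < 1) {e : Eu n} (he : e ≠ 0) :
    ∃ ω, affineFun hζ e ω ≠ 0 := by
  by_contra! h
  obtain ⟨ω, hω⟩ := exists_smul_sphere e
  have h1 := h ω
  have h2 := h (-ω)
  simp only [affineFun, kern_one, ContinuousMap.sub_apply, ContinuousMap.smul_apply, lin_apply,
    ContinuousMap.one_apply, smul_eq_mul, coe_neg_sphere, inner_neg_right] at h1 h2
  have hk : projCoeff hζ e = 0 := by linarith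
  rw [hk, zero_mul, sub_zero] at h1
  have h3 : inner ℝ e (ω : Eu n) = ‖e‖ := by
    have hin : inner ℝ (ω : Eu n) (ω : Eu n) = (1 : ℝ) := by
      rw [real_inner_self_eq_norm_sq]; simp
    conv_lhs => rw [hω, real_inner_smul_left, hin, mul_one]
  exact he (norm_eq_zero.1 (h3 ▸ h1))

/-- The tangent vectors orthogonal to `(1 - ζ·ω)^(s-n/2)`. -/
def tangentMap (s : ℝ) (hζ : ‖ζ‖ < 1) : Eu n →ₗ[ℝ] L2 n where
  toFun e := toL2 n (affineFun hζ e * kern (s - n / 2 - 1) hζ)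
  map_add' e e' := by
    rw [← map_add, ← add_mul]
    congr 2
    simp only [affineFun, projCoeff, lin_add, map_add, inner_add_left, add_div, add_smul]
    abel
  map_smul' c e := by
    rw [RingHom.id_apply, ← map_smul, ← smul_mul_assoc]
    congr 2
    simp only [affineFun, projCoeff, lin_smul, map_smul, real_inner_smul_left, mul_div_assoc,
      smul_sub, smul_smul]

lemma tangentMap_eq (hζ : ‖ζ‖ < 1) (e : Eu n) :
    tangentMap s hζ e = toL2 n (lin e * kern (s - n / 2 - 1) hζ) +
      (-projCoeff hζ e) • toL2 n (kern (s - n / 2) hζ) := by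
  change toL2 n _ = _
  rw [← map_smul, ← map_add, affineFun, sub_mul, smul_mul_assoc, kern_mul_kern, neg_smul,
    ← sub_eq_add_neg, add_sub_cancel]

lemma isImage_tangentMap (hn : 1 ≤ n) (hs : Admissible n s) (hζ : ‖ζ‖ < 1) (e : Eu n) :
    IsImage n s (tangentMap s hζ e) (toL2 n (linKernImage s hζ e) +
      (-projCoeff hζ e) • toL2 n ((α n s 0 * (1 - ‖ζ‖ ^ 2) ^ s) • kern (-n - (s - n / 2)) hζ)) := by
  rw [tangentMap_eq]
  exact (isImage_lin_mul_kern hn hs hζ e).add ((isImage_kern hn hs hζ).smul _)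

/-- By the choice of `projCoeff` the vector is L²-orthogonal to (1 - ζ·ω)^(-n-β). Only the second
term of `linKernImage` survives, giving a negative multiple of the integral of the squared affine
function against (1 - ζ·ω)^(-n-2). -/
lemma aQuad_tangentMap_neg (hn : 1 ≤ n) (hs : Admissible n s) (hα : 0 < α n s 0) (hζ : ‖ζ‖ < 1)
    {e : Eu n} (he : e ≠ 0) : aQuad n s (tangentMap s hζ e) < 0 := by
  have hβ := hs.pos
  have hq := one_sub_norm_sq_pos hζ
  have hort : inner ℝ (tangentMap s hζ e) (toL2 n (kern (-n - (s - n / 2)) hζ)) = 0 := by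
    change inner ℝ (toL2 n _) _ = 0
    rw [inner_toL2, ← integral_affineFun_mul_kern hζ e]
    congr 1; ext ω
    rw [← ContinuousMap.mul_apply, mul_assoc, kern_mul_kern, ContinuousMap.mul_apply]
    congr 3; ring
  have hsq : inner ℝ (tangentMap s hζ e) (toL2 n (lin e * kern (-n - (s - n / 2) - 1) hζ)) =
      ∫ ω, affineFun hζ e ω ^ 2 * kern (-n - 2) hζ ω ∂(surf n) := by
    have e1 : lin e * kern (-n - (s - n / 2) - 1) hζ =
        affineFun hζ e * kern (-n - (s - n / 2) - 1) hζ +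
          projCoeff hζ e • kern (-n - (s - n / 2)) hζ := by
      rw [affineFun, sub_mul, smul_mul_assoc, kern_mul_kern, add_sub_cancel, sub_add_cancel]
    rw [e1, map_add, map_smul, inner_add_right, real_inner_smul_right, hort, mul_zero, add_zero]
    change inner ℝ (toL2 n _) _ = _
    rw [inner_toL2]
    congr 1; ext ω
    have e2 : kern (s - n / 2 - 1) hζ ω * kern (-n - (s - n / 2) - 1) hζ ω = kern (-n - 2) hζ ω := by
      rw [← ContinuousMap.mul_apply, kern_mul_kern]; congr 2; ring
    simp only [ContinuousMap.mul_apply]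
    rw [← e2]; ring
  have hpos : 0 < ∫ ω, affineFun hζ e ω ^ 2 * kern (-n - 2) hζ ω ∂(surf n) := by
    obtain ⟨ω, hω⟩ := exists_affineFun_ne_zero hζ he
    refine integral_pos_of_nonneg_of_ne (by fun_prop) (fun ω => ?_) (ω₀ := ω) ?_
    · exact mul_nonneg (sq_nonneg _) (kern_pos _ hζ ω).le
    · exact mul_ne_zero (pow_ne_zero 2 hω) (kern_pos _ hζ ω).ne'
  rw [aQuad_eq_aBilin, (isImage_tangentMap hn hs hζ e).aBilin_eq hn, linKernImage]
  simp only [map_smul, map_sub, inner_add_right, inner_sub_right, real_inner_smul_right, hort, hsq]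
  have hc : 0 < α n s 0 / (s - n / 2) * (1 - ‖ζ‖ ^ 2) ^ (s - 1) * ((n + (s - n / 2)) * (1 - ‖ζ‖ ^ 2)) := by
    positivity
  nlinarith [mul_pos hc hpos]

end negative

/-- The quadratic form is positive definite on the orthogonal complement of a tangent space. -/
theorem aQuad_pos_of_mem_tangentPerp (hn : 1 ≤ n) {s : ℝ} (hs : Admissible n s) {h : C(Sph n, ℝ)}
    (hh : h ∈ optimizers n s) {ρ : L2 n} (hρ : ρ ∈ tangentPerp n s h) (hρ0 : ρ ≠ 0) :
    0 < aQuad n s ρ := by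
  obtain ⟨c, hc, ζ, hζ, rfl⟩ := mem_optimizers_iff.1 hh
  have hρH := hρ.1
  have h1 := hρ.2 _ (kern_mem_tangentSpace hc hζ)
  have h2 := fun e => hρ.2 _ (lin_mul_kern_mem_tangentSpace hs hc hζ e)
  have hkH := (isImage_kern hn hs hζ).mem_Hs hn hs
  have hα0 := α_zero_mul hs
  have hα1 := α_one_mul hs
  rcases lt_or_gt_of_ne (show s - n / 2 ≠ 1 from fun h => by simp [h] at hα0) with hβ | hβ
  · have ha0 : α n s 0 < 0 := neg_of_mul_neg_left hα0 (by linarith)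
    have ha1 : 0 < α n s 1 := pos_of_mul_pos_left hα1 (by linarith)
    refine aQuad_pos_of_orthogonal hn hs (V := ℝ) (W := ℝ) le_rfl
      (LinearMap.toSpanSingleton ℝ (L2 n) (toL2 n (kern (s - n / 2) hζ)))
      (innerSL ℝ (toL2 n (1 : C(Sph n, ℝ)))).toLinearMap (ℓ₀ := 0) (fun ℓ hℓ => ?_)
      (fun u hu => P_zero_eq_zero hu) (fun y => Hs_smul hkH y) (fun y hy => ?_) hρH hρ0 (fun y => ?_)
    · rcases ℓ with _ | _ | ℓ
      · exact absurd rfl hℓ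
      · exact ha1
      · exact α_pos_of_two_le hs (by omega)
    · rw [LinearMap.toSpanSingleton_apply, aQuad_smul, aQuad_kern hn hs]
      have := integral_kern_pos (-n) hζ
      have := Real.rpow_pos_of_pos (one_sub_norm_sq_pos hζ) s
      refine mul_neg_of_pos_of_neg (by positivity) ?_
      rw [mul_assoc]
      exact mul_neg_of_neg_of_pos ha0 (by positivity)
    · rw [LinearMap.toSpanSingleton_apply, aBilin_smul_right, h1, mul_zero]
  · have ha0 : 0 < α n s 0 := by
      by_contra! h
      nlinarith
    refine aQuad_pos_of_orthogonal hn hs (V := Eu n) (W := Fin (n + 1) → ℝ) (by simp)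
      (tangentMap s hζ)
      (LinearMap.pi fun i => (innerSL ℝ (toL2 n (lin (EuclideanSpace.single i (1 : ℝ))))).toLinearMap)
      (ℓ₀ := 1) (fun ℓ hℓ => ?_) (fun u hu => P_one_eq_zero fun i => congrFun hu i)
      (fun e => (isImage_tangentMap hn hs hζ e).mem_Hs hn hs)
      (fun e he => aQuad_tangentMap_neg hn hs ha0 hζ he) hρH hρ0 (fun e => ?_)
    · rcases ℓ with _ | _ | ℓ
      · exact ha0
      · exact absurd rfl hℓ
      · exact α_pos_of_two_le hs (by omega)
    · rw [tangentMap_eq, aBilin_add_right hn hs ((isImage_lin_mul_kern hn hs hζ e).mem_Hs hn hs)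
        (Hs_smul hkH _) hρH, aBilin_smul_right, h1, h2]
      ring

/-! ### Explicit integrals of kernels -/

/-- The surface area of the sphere. -/
def area (n : ℕ) : ℝ := (surf n).real Set.univ

lemma area_eq_integral (n : ℕ) : area n = ∫ _ : Sph n, (1 : ℝ) ∂(surf n) := by simp [area]

lemma area_pos (n : ℕ) : 0 < area n := by
  rw [area_eq_integral]
  exact integral_pos_of_nonneg_of_ne continuous_const (fun _ => zero_le_one)
    (ω₀ := Classical.arbitrary _) one_ne_zero

/-- The intertwining relation for ℓ = 0, tested against the constant 1. -/
lemma integral_kern_eq (hn : 1 ≤ n) (κ : ℝ) {ζ : Eu n} (hζ : ‖ζ‖ < 1) :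
    ∫ ω, kern κ hζ ω ∂(surf n) =
      (1 - ‖ζ‖ ^ 2) ^ ((n : ℝ) / 2 + κ) * ∫ ω, kern (-n - κ) hζ ω ∂(surf n) := by
  have h := integral_harmonic_kernel hn (MvPolynomial.isHomogeneous_one (Fin (n + 1)) ℝ)
    (polyLaplacian_eq_zero_of_lt (MvPolynomial.isHomogeneous_one (Fin (n + 1)) ℝ) two_pos) κ hζ
  have h1 : ∀ ω : Sph n, restrictPoly n 1 ω = 1 := fun ω => by simp [restrictPoly_apply, evalE]
  simpa [h1, kern_apply] using h

lemma integral_kern_neg_natCast (hn : 1 ≤ n) {ζ : Eu n} (hζ : ‖ζ‖ < 1) :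
    ∫ ω, kern (-n) hζ ω ∂(surf n) = area n * (1 - ‖ζ‖ ^ 2) ^ (-(n : ℝ) / 2) := by
  have h := integral_kern_eq hn 0 hζ
  have hq := one_sub_norm_sq_pos hζ
  rw [kern_zero, sub_zero, add_zero] at h
  have h1 : ∫ ω : Sph n, (1 : C(Sph n, ℝ)) ω ∂(surf n) = area n := (area_eq_integral n).symm
  rw [← h1, h, mul_comm, ← mul_assoc, ← Real.rpow_add hq]
  simp [neg_div]

/-- The derivative in ζ, in direction e, of the formula for ∫ (1 - ζ·ω)^(-n). -/
lemma integral_lin_mul_kern (hn : 1 ≤ n) {ζ : Eu n} (hζ : ‖ζ‖ < 1) (e : Eu n) :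
    (1 - ‖ζ‖ ^ 2) * ∫ ω, (lin e * kern (-n - 1) hζ) ω ∂(surf n) =
      inner ℝ ζ e * ∫ ω, kern (-n) hζ ω ∂(surf n) := by
  have hq := one_sub_norm_sq_pos hζ
  have hn' : (0 : ℝ) < n := by exact_mod_cast hn
  have h1 := hasDerivAt_integral_kernel 1 (-n) hζ e
  have h2 := (hasDerivAt_one_sub_norm_sq_rpow hζ e (-(n : ℝ) / 2)).const_mul (area n)
  have hU : ∀ᶠ t : ℝ in 𝓝 0, ‖ζ + t • e‖ < 1 :=
    (isOpen_lt (by fun_prop : Continuous fun t : ℝ => ‖ζ + t • e‖) continuous_const).mem_nhds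
      (by simpa using hζ)
  have heq := h1.unique (h2.congr_of_eventuallyEq (by
    filter_upwards [hU] with t ht
    rw [← integral_kern_neg_natCast hn ht]
    simp [kern_apply]))
  rw [integral_kern_neg_natCast hn hζ]
  have hp : (1 - ‖ζ‖ ^ 2) ^ (-(n : ℝ) / 2) =
      (1 - ‖ζ‖ ^ 2) ^ (-(n : ℝ) / 2 - 1) * (1 - ‖ζ‖ ^ 2) := by
    rw [← Real.rpow_add_one hq.ne', sub_add_cancel]
  rw [hp]
  simp only [ContinuousMap.one_apply, one_mul] at heq
  refine mul_left_cancel₀ hn'.ne' ?_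
  linear_combination (1 - ‖ζ‖ ^ 2) * heq

/-- With x = ζ·ω, (1 - x)^κ ≥ ((1 - x)/2)² ≥ (1 - 2x)/4 for κ in [0, 2], and the linear term
integrates to zero. The bound is uniform up to the boundary of the ball. -/
lemma area_div_four_le_integral_kern (hn : 1 ≤ n) {κ : ℝ} (h0 : 0 ≤ κ) (h2 : κ ≤ 2) {ζ : Eu n}
    (hζ : ‖ζ‖ < 1) : area n / 4 ≤ ∫ ω, kern κ hζ ω ∂(surf n) := by
  have hlin : ∫ ω, lin ζ ω ∂(surf n) = 0 := by
    have := moment_one_eq_zero hn (MvPolynomial.isHomogeneous_one (Fin (n + 1)) ℝ) ζ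
    rw [moment_eq] at this
    simpa [restrictPoly_apply, evalE, lin_apply] using this
  have hle : ∀ ω, (1 - 2 * lin ζ ω) / 4 ≤ kern κ hζ ω := by
    intro ω
    have hx := abs_le.1 ((abs_inner_le ζ ω).trans hζ.le)
    have hp := one_sub_inner_pos hζ ω
    rw [lin_apply, kern_apply]
    set x := inner ℝ ζ (ω : Eu n)
    have hy : 0 < (1 - x) / 2 := by linarith
    have hy1 : (1 - x) / 2 ≤ 1 := by linarith [hx.1]
    have e1 : ((1 - x) / 2) ^ (2 : ℝ) ≤ ((1 - x) / 2) ^ κ :=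
      Real.rpow_le_rpow_of_exponent_ge hy hy1 h2
    have e2 : ((1 - x) / 2) ^ κ ≤ (1 - x) ^ κ := Real.rpow_le_rpow hy.le (by linarith) h0
    rw [Real.rpow_two] at e1
    nlinarith [sq_nonneg x]
  calc area n / 4 = ∫ ω, (1 - 2 * lin ζ ω) / 4 ∂(surf n) := by
        rw [integral_div, integral_sub (integrable_const _)
          (continuous_integrable (by fun_prop)), integral_const_mul, hlin, ← area_eq_integral]
        ring
    _ ≤ _ := integral_mono (continuous_integrable (by fun_prop))
        (continuous_integrable (kern κ hζ).continuous) hle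

lemma aQuad_kern_eq (hn : 1 ≤ n) {s : ℝ} (hs : Admissible n s) {ζ : Eu n} (hζ : ‖ζ‖ < 1) :
    aQuad n s (toL2 n (kern (s - n / 2) hζ)) =
      α n s 0 * area n * (1 - ‖ζ‖ ^ 2) ^ (s - n / 2) := by
  rw [aQuad_kern hn hs, integral_kern_neg_natCast hn, show s - (n : ℝ) / 2 = s + -(n : ℝ) / 2 by ring,
    Real.rpow_add (one_sub_norm_sq_pos hζ)]
  ring

/-! ### The functional G and its minimum -/

/-- The functional whose critical points give the decompositions of `f`. -/
def confMoment (s : ℝ) (f : C(Sph n, ℝ)) (ζ : Eu n) : ℝ :=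
  (1 - ‖ζ‖ ^ 2) ^ ((n + (s - n / 2)) / 2) *
    ∫ ω : Sph n, f ω * (1 - inner ℝ ζ (ω : Eu n)) ^ (-n - (s - n / 2)) ∂(surf n)

/-- A multiple of the derivative of `confMoment` in the direction `e`. -/
def critFun (s : ℝ) (f : C(Sph n, ℝ)) (e ζ : Eu n) : ℝ :=
  (1 - ‖ζ‖ ^ 2) *
      ∫ ω : Sph n, (f * lin e) ω * (1 - inner ℝ ζ (ω : Eu n)) ^ (-n - (s - n / 2) - 1) ∂(surf n) -
    inner ℝ ζ e * ∫ ω : Sph n, f ω * (1 - inner ℝ ζ (ω : Eu n)) ^ (-n - (s - n / 2)) ∂(surf n)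

section decomposition

variable {s : ℝ} {f : C(Sph n, ℝ)}

lemma continuousOn_confMoment {R : ℝ} (hR : R < 1) :
    ContinuousOn (confMoment s f) (Metric.closedBall 0 R) := by
  refine ContinuousOn.mul (ContinuousOn.rpow_const (by fun_prop) fun ζ hζ => Or.inl ?_)
    (continuousOn_integral_kernel f _ hR)
  exact (one_sub_norm_sq_pos (lt_of_le_of_lt (by simpa using hζ) hR)).ne'

lemma continuousOn_critFun {R : ℝ} (hR : R < 1) (e : Eu n) :
    ContinuousOn (critFun s f e) (Metric.closedBall 0 R) :=
  (ContinuousOn.mul (by fun_prop) (continuousOn_integral_kernel _ _ hR)).sub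
    (ContinuousOn.mul (by fun_prop) (continuousOn_integral_kernel _ _ hR))

lemma hasDerivAt_confMoment {ζ : Eu n} (hζ : ‖ζ‖ < 1) (e : Eu n) :
    HasDerivAt (fun t : ℝ => confMoment s f (ζ + t • e))
      ((n + (s - n / 2)) * (1 - ‖ζ‖ ^ 2) ^ ((n + (s - n / 2)) / 2 - 1) * critFun s f e ζ) 0 := by
  have hq := one_sub_norm_sq_pos hζ
  refine ((hasDerivAt_one_sub_norm_sq_rpow hζ e _).mul
    (hasDerivAt_integral_kernel f _ hζ e)).congr_deriv ?_
  have hp : (1 - ‖ζ‖ ^ 2) ^ ((n + (s - n / 2)) / 2) =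
      (1 - ‖ζ‖ ^ 2) ^ ((n + (s - n / 2)) / 2 - 1) * (1 - ‖ζ‖ ^ 2) := by
    rw [← Real.rpow_add_one hq.ne', sub_add_cancel]
  simp only [zero_smul, add_zero, hp, critFun, ContinuousMap.mul_apply, kern_apply, ← mul_assoc]
  ring

lemma confMoment_pos (hf : ∀ ω, 0 < f ω) {ζ : Eu n} (hζ : ‖ζ‖ < 1) : 0 < confMoment s f ζ := by
  refine mul_pos (Real.rpow_pos_of_pos (one_sub_norm_sq_pos hζ) _) ?_
  have hpos : ∀ ω, 0 < (f * kern (-n - (s - n / 2)) hζ) ω :=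
    fun ω => mul_pos (hf ω) (kern_pos _ hζ ω)
  exact integral_pos_of_nonneg_of_ne (f * kern (-n - (s - n / 2)) hζ).continuous
    (fun ω => (hpos ω).le) (hpos (Classical.arbitrary _)).ne'

/-- Replacing f by its lower bound m leaves, by `integral_kern_eq`, the integral of (1 - ζ·ω)^β,
which stays bounded below. -/
lemma le_confMoment (hn : 1 ≤ n) (hs : Admissible n s) {m : ℝ} (hm : 0 ≤ m) (hf : ∀ ω, m ≤ f ω)
    {ζ : Eu n} (hζ : ‖ζ‖ < 1) :
    m * (area n / 4) ≤ (1 - ‖ζ‖ ^ 2) ^ ((s - n / 2) / 2) * confMoment s f ζ := by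
  have hβ := hs.pos
  have hq := one_sub_norm_sq_pos hζ
  have h1 := area_div_four_le_integral_kern hn hβ.le hs.lt_two.le hζ
  rw [integral_kern_eq hn (s - n / 2) hζ] at h1
  have h2 : m * ∫ ω, kern (-n - (s - n / 2)) hζ ω ∂(surf n) ≤
      ∫ ω, f ω * kern (-n - (s - n / 2)) hζ ω ∂(surf n) := by
    rw [← integral_const_mul]
    refine integral_mono (continuous_integrable (by fun_prop)) (continuous_integrable (by fun_prop))
      fun ω => ?_
    exact mul_le_mul_of_nonneg_right (hf ω) (kern_pos _ hζ ω).le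
  have h3 : (1 - ‖ζ‖ ^ 2) ^ ((s - n / 2) / 2) * confMoment s f ζ =
      (1 - ‖ζ‖ ^ 2) ^ ((n : ℝ) / 2 + (s - n / 2)) *
        ∫ ω, f ω * kern (-n - (s - n / 2)) hζ ω ∂(surf n) := by
    rw [confMoment, ← mul_assoc, ← Real.rpow_add hq]
    congr 2; ring
  rw [h3]
  calc m * (area n / 4) ≤ m * ((1 - ‖ζ‖ ^ 2) ^ ((n : ℝ) / 2 + (s - n / 2)) *
        ∫ ω, kern (-n - (s - n / 2)) hζ ω ∂(surf n)) := by gcongr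
    _ = (1 - ‖ζ‖ ^ 2) ^ ((n : ℝ) / 2 + (s - n / 2)) *
        (m * ∫ ω, kern (-n - (s - n / 2)) hζ ω ∂(surf n)) := by ring
    _ ≤ _ := by gcongr

/-- Sublevel sets of `confMoment` stay away from the boundary of the ball. -/
lemma exists_radius (hn : 1 ≤ n) (hs : Admissible n s) (hf : ∀ ω, 0 < f ω) {B : ℝ} (hB : 0 < B) :
    ∃ R : ℝ, 0 ≤ R ∧ R < 1 ∧ ∀ ζ : Eu n, ‖ζ‖ < 1 → confMoment s f ζ ≤ B → ‖ζ‖ ≤ R := by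
  have hβ := hs.pos
  obtain ⟨ω₀, hω₀⟩ : ∃ ω₀, ∀ ω, f ω₀ ≤ f ω := by
    obtain ⟨ω₀, -, h⟩ := isCompact_univ.exists_isMinOn Set.univ_nonempty f.continuous.continuousOn
    exact ⟨ω₀, fun ω => h (Set.mem_univ ω)⟩
  set K := f ω₀ * (area n / 4) with hK
  have hKpos : 0 < K := mul_pos (hf ω₀) (by linarith [area_pos n])
  -- Solves K = δ^(β/2) B, the limiting case of `le_confMoment` when G ≤ B.
  set δ := (K / B) ^ (2 / (s - n / 2)) with hδ
  have hδpos : 0 < δ := Real.rpow_pos_of_pos (div_pos hKpos hB) _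
  refine ⟨Real.sqrt (1 - δ), Real.sqrt_nonneg _, ?_, fun ζ hζ hle => ?_⟩
  · rw [Real.sqrt_lt' one_pos]; linarith
  · have hq := one_sub_norm_sq_pos hζ
    have h1 := le_confMoment hn hs (hf ω₀).le hω₀ hζ
    have hxp := Real.rpow_pos_of_pos hq ((s - n / 2) / 2)
    have h2 : K / B ≤ (1 - ‖ζ‖ ^ 2) ^ ((s - n / 2) / 2) := by
      rw [div_le_iff₀ hB]
      exact h1.trans (mul_le_mul_of_nonneg_left hle hxp.le)
    have h3 : δ ≤ 1 - ‖ζ‖ ^ 2 := by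
      have := Real.rpow_le_rpow (div_pos hKpos hB).le h2 (z := 2 / (s - n / 2)) (by positivity)
      rwa [← Real.rpow_mul hq.le, show (s - (n : ℝ) / 2) / 2 * (2 / (s - n / 2)) = 1 by
          rw [div_mul_div_comm, mul_comm, div_self (by positivity)],
        Real.rpow_one] at this
    exact Real.le_sqrt_of_sq_le (by linarith)

lemma exists_confMoment_min (hn : 1 ≤ n) (hs : Admissible n s) (hf : ∀ ω, 0 < f ω) :
    ∃ ζ₀ : Eu n, ‖ζ₀‖ < 1 ∧ (∀ ζ : Eu n, ‖ζ‖ < 1 → confMoment s f ζ₀ ≤ confMoment s f ζ) ∧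
      ∀ e, critFun s f e ζ₀ = 0 := by
  obtain ⟨R, hR0, hR1, hR⟩ := exists_radius hn hs hf
    (confMoment_pos (s := s) hf (ζ := 0) (by simp))
  obtain ⟨ζ₀, hζ₀, hmin⟩ := (isCompact_closedBall (0 : Eu n) R).exists_isMinOn
    ⟨0, by simpa using hR0⟩ (continuousOn_confMoment (s := s) (f := f) hR1)
  have hζ₀' : ‖ζ₀‖ < 1 := lt_of_le_of_lt (by simpa using hζ₀) hR1
  have hglob : ∀ ζ : Eu n, ‖ζ‖ < 1 → confMoment s f ζ₀ ≤ confMoment s f ζ := by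
    intro ζ hζ
    rcases le_total (confMoment s f ζ) (confMoment s f 0) with h | h
    · exact hmin (by simpa using hR ζ hζ h)
    · exact (hmin (by simpa using hR0)).trans h
  refine ⟨ζ₀, hζ₀', hglob, fun e => ?_⟩
  have hd := hasDerivAt_confMoment (s := s) (f := f) hζ₀' e
  have hU : ∀ᶠ t : ℝ in 𝓝 0, ‖ζ₀ + t • e‖ < 1 :=
    (isOpen_lt (by fun_prop : Continuous fun t : ℝ => ‖ζ₀ + t • e‖) continuous_const).mem_nhds
      (by simpa using hζ₀')
  have hloc : IsLocalMin (fun t : ℝ => confMoment s f (ζ₀ + t • e)) 0 := by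
    filter_upwards [hU] with t ht
    simpa using hglob _ ht
  have h0 := hloc.hasDerivAt_eq_zero hd
  have hβ := hs.pos
  exact (mul_eq_zero.1 h0).resolve_left (mul_ne_zero (by positivity)
    (Real.rpow_pos_of_pos (one_sub_norm_sq_pos hζ₀') _).ne')

/-! ### Decompositions as critical points, and the attained infimum -/

/-- Orthogonality to h fixes c in terms of ζ. Once it holds, orthogonality to the remaining tangent
vectors says exactly that the derivative of G at ζ vanishes. -/
lemma sub_mem_tangentPerp_iff (hn : 1 ≤ n) (hs : Admissible n s) (hu : toL2 n f ∈ Hs n s) {c : ℝ}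
    (hc : 0 < c) {ζ : Eu n} (hζ : ‖ζ‖ < 1) :
    toL2 n f - toL2 n (c • kern (s - n / 2) hζ) ∈ tangentPerp n s (c • kern (s - n / 2) hζ) ↔
      c * (area n * (1 - ‖ζ‖ ^ 2) ^ ((s - n / 2) / 2)) = confMoment s f ζ ∧
        ∀ e, critFun s f e ζ = 0 := by
  have hq := one_sub_norm_sq_pos hζ
  have hkH := (isImage_kern hn hs hζ).mem_Hs hn hs
  set N := ∫ ω, kern (-n) hζ ω ∂(surf n) with hN
  set I := ∫ ω : Sph n, f ω * (1 - inner ℝ ζ (ω : Eu n)) ^ (-n - (s - n / 2)) ∂(surf n) with hI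
  have e1 : inner ℝ (toL2 n f - toL2 n (c • kern (s - n / 2) hζ))
      (toL2 n (kern (-n - (s - n / 2)) hζ)) = I - c * N := by
    rw [inner_sub_left, map_smul, real_inner_smul_left, inner_toL2, inner_toL2]
    congr 2
    refine integral_congr_ae (Filter.Eventually.of_forall fun ω => ?_)
    dsimp only
    rw [← ContinuousMap.mul_apply, kern_mul_kern]; congr 2; ring
  have e2 : ∀ e, (1 - ‖ζ‖ ^ 2) * inner ℝ (toL2 n f - toL2 n (c • kern (s - n / 2) hζ))
      (toL2 n (lin e * kern (-n - (s - n / 2) - 1) hζ)) =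
        critFun s f e ζ + inner ℝ ζ e * (I - c * N) := by
    intro e
    have h1 : ∫ ω, f ω * (lin e * kern (-n - (s - n / 2) - 1) hζ) ω ∂(surf n) =
        ∫ ω : Sph n, (f * lin e) ω * (1 - inner ℝ ζ (ω : Eu n)) ^ (-n - (s - n / 2) - 1)
          ∂(surf n) := by
      congr 1; ext ω
      simp only [ContinuousMap.mul_apply, kern_apply]; ring
    have h2 : ∫ ω, kern (s - n / 2) hζ ω * (lin e * kern (-n - (s - n / 2) - 1) hζ) ω ∂(surf n) =
        ∫ ω, (lin e * kern (-n - 1) hζ) ω ∂(surf n) := by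
      congr 1; ext ω
      rw [← ContinuousMap.mul_apply, mul_left_comm, kern_mul_kern]; congr 3; ring
    rw [inner_sub_left, map_smul, real_inner_smul_left, inner_toL2, inner_toL2, h1, h2, critFun]
    linear_combination -c * integral_lin_mul_kern hn hζ e
  have e3 : I = c * N ↔ c * (area n * (1 - ‖ζ‖ ^ 2) ^ ((s - n / 2) / 2)) = confMoment s f ζ := by
    have hp := Real.rpow_pos_of_pos hq ((n + (s - n / 2)) / 2)
    rw [confMoment, ← hI, hN, integral_kern_neg_natCast hn hζ,
      show (1 - ‖ζ‖ ^ 2) ^ ((s - (n : ℝ) / 2) / 2) = (1 - ‖ζ‖ ^ 2) ^ ((n + (s - n / 2)) / 2) *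
        (1 - ‖ζ‖ ^ 2) ^ (-(n : ℝ) / 2) by rw [← Real.rpow_add hq]; congr 1; ring]
    constructor
    · intro h; rw [h]; ring
    · intro h
      refine mul_left_cancel₀ hp.ne' ?_
      rw [← h]; ring
  rw [mem_tangentPerp_iff hn hs hc hζ, e1, sub_eq_zero, ← e3]
  constructor
  · rintro ⟨-, h1, h2⟩
    refine ⟨h1, fun e => ?_⟩
    have := e2 e
    rw [h2 e, h1] at this
    linarith
  · rintro ⟨h1, h2⟩
    refine ⟨Hs_sub hu (by rw [map_smul]; exact Hs_smul hkH c), h1, fun e => ?_⟩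
    have := e2 e
    rw [h1, h2 e, sub_self, mul_zero, add_zero] at this
    exact eq_zero_of_ne_zero_of_mul_left_eq_zero (ne_of_gt hq) this

/-- The values of the quadratic form in the decompositions of `f`, in terms of the critical points
of `confMoment`. -/
lemma mem_distValues_iff (hn : 1 ≤ n) (hs : Admissible n s) (hu : toL2 n f ∈ Hs n s)
    (hf : ∀ ω, 0 < f ω) (t : ℝ) :
    t ∈ distValues n s (toL2 n f) ↔ ∃ ζ : Eu n, ‖ζ‖ < 1 ∧ (∀ e, critFun s f e ζ = 0) ∧
      t = aQuad n s (toL2 n f) - α n s 0 * confMoment s f ζ ^ 2 / area n := by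
  have hA := area_pos n
  have hval : ∀ (ζ : Eu n) (hζ : ‖ζ‖ < 1) (c : ℝ), 0 < c →
      toL2 n f - toL2 n (c • kern (s - n / 2) hζ) ∈ tangentPerp n s (c • kern (s - n / 2) hζ) →
      aQuad n s (toL2 n f - toL2 n (c • kern (s - n / 2) hζ)) =
        aQuad n s (toL2 n f) - α n s 0 * confMoment s f ζ ^ 2 / area n := by
    intro ζ hζ c hc hρ
    have hq := one_sub_norm_sq_pos hζ
    have hkH := (isImage_kern hn hs hζ).mem_Hs hn hs
    have hort := hρ.2 _ (kern_mem_tangentSpace hc hζ)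
    have hcG := ((sub_mem_tangentPerp_iff hn hs hu hc hζ).1 hρ).1
    set ρ := toL2 n f - toL2 n (c • kern (s - n / 2) hζ) with hρdef
    -- The kernel is itself tangent, so the cross term vanishes in the expansion of the form at f.
    have hsum : toL2 n f = ρ + c • toL2 n (kern (s - n / 2) hζ) := by
      rw [hρdef, map_smul, sub_add_cancel]
    have h1 := aQuad_add hn hs hρ.1 (Hs_smul hkH c)
    rw [← hsum, aBilin_smul_right, hort, aQuad_smul, aQuad_kern_eq hn hs hζ] at h1
    have h2 : (1 - ‖ζ‖ ^ 2) ^ (s - (n : ℝ) / 2) = ((1 - ‖ζ‖ ^ 2) ^ ((s - (n : ℝ) / 2) / 2)) ^ 2 := by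
      rw [← Real.rpow_mul_natCast hq.le]; congr 1; push_cast; ring
    rw [h2] at h1
    rw [← hcG, h1]
    generalize (1 - ‖ζ‖ ^ 2) ^ ((s - (n : ℝ) / 2) / 2) = y
    field_simp
    ring
  constructor
  · rintro ⟨h, hh, ρ, hρ, hsum, rfl⟩
    obtain ⟨c, hc, ζ, hζ, rfl⟩ := mem_optimizers_iff.1 hh
    obtain rfl : ρ = toL2 n f - toL2 n (c • kern (s - n / 2) hζ) := by rw [hsum, add_sub_cancel_left]
    exact ⟨ζ, hζ, ((sub_mem_tangentPerp_iff hn hs hu hc hζ).1 hρ).2, hval ζ hζ c hc hρ⟩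
  · rintro ⟨ζ, hζ, hcrit, rfl⟩
    have hq := one_sub_norm_sq_pos hζ
    have hp := Real.rpow_pos_of_pos hq ((s - n / 2) / 2)
    set c := confMoment s f ζ / (area n * (1 - ‖ζ‖ ^ 2) ^ ((s - n / 2) / 2)) with hcdef
    have hc : 0 < c := div_pos (confMoment_pos hf hζ) (by positivity)
    have hρ := (sub_mem_tangentPerp_iff hn hs hu hc hζ).2
      ⟨by rw [hcdef, div_mul_cancel₀]; positivity, hcrit⟩
    exact ⟨c • kern (s - n / 2) hζ, mem_optimizers_iff.2 ⟨c, hc, ζ, hζ, rfl⟩, _, hρ,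
      by rw [add_sub_cancel], (hval ζ hζ c hc hρ).symm⟩

lemma distValues_nonempty (hn : 1 ≤ n) (hs : Admissible n s) (hu : toL2 n f ∈ Hs n s)
    (hf : ∀ ω, 0 < f ω) : (distValues n s (toL2 n f)).Nonempty := by
  obtain ⟨ζ, hζ, -, hcrit⟩ := exists_confMoment_min hn hs hf
  exact ⟨_, (mem_distValues_iff hn hs hu hf _).2 ⟨ζ, hζ, hcrit, rfl⟩⟩

lemma nonneg_of_mem_distValues (hn : 1 ≤ n) (hs : Admissible n s) {u : L2 n} {t : ℝ}
    (ht : t ∈ distValues n s u) : 0 ≤ t := by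
  obtain ⟨h, hh, ρ, hρ, -, rfl⟩ := ht
  by_cases h0 : ρ = 0
  · simp [h0, aQuad]
  · exact (aQuad_pos_of_mem_tangentPerp hn hs hh hρ h0).le

lemma pos_of_mem_distValues (hn : 1 ≤ n) (hs : Admissible n s) {u : L2 n}
    (hu : u ∉ toL2 n '' optimizers n s) {t : ℝ} (ht : t ∈ distValues n s u) : 0 < t := by
  obtain ⟨h, hh, ρ, hρ, hsum, rfl⟩ := ht
  refine aQuad_pos_of_mem_tangentPerp hn hs hh hρ fun h0 => hu ⟨h, hh, ?_⟩
  rw [hsum, h0, add_zero]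

lemma exists_isLeast_distValues (hn : 1 ≤ n) (hs : Admissible n s) (hu : toL2 n f ∈ Hs n s)
    (hf : ∀ ω, 0 < f ω) : ∃ t, IsLeast (distValues n s (toL2 n f)) t := by
  have hA := area_pos n
  obtain ⟨ζ₀, hζ₀, hmin, hcrit⟩ := exists_confMoment_min hn hs hf
  have hmem := mem_distValues_iff hn hs hu hf
  set val : Eu n → ℝ := fun ζ =>
    aQuad n s (toL2 n f) - α n s 0 * confMoment s f ζ ^ 2 / area n with hvaldef
  rcases lt_or_gt_of_ne (α_ne_zero hs 0) with hα | hα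
  · refine ⟨val ζ₀, (hmem _).2 ⟨ζ₀, hζ₀, hcrit, rfl⟩, fun t ht => ?_⟩
    obtain ⟨ζ, hζ, -, rfl⟩ := (hmem t).1 ht
    have h1 : confMoment s f ζ₀ ^ 2 ≤ confMoment s f ζ ^ 2 :=
      pow_le_pow_left₀ (confMoment_pos hf hζ₀).le (hmin ζ hζ) 2
    have h2 : α n s 0 * confMoment s f ζ ^ 2 / area n ≤ α n s 0 * confMoment s f ζ₀ ^ 2 / area n := by
      gcongr ?_ / _
      exact mul_le_mul_of_nonpos_left h1 hα.le
    simp only [hvaldef]; linarith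
  -- Nonnegativity of the form on complements bounds G² at critical points; the summand 1 lets this
  -- bound G as well.
  · set B := 1 + aQuad n s (toL2 n f) * area n / α n s 0 with hBdef
    have hbound : ∀ ζ : Eu n, ‖ζ‖ < 1 → (∀ e, critFun s f e ζ = 0) → 
        confMoment s f ζ ^ 2 ≤ aQuad n s (toL2 n f) * area n / α n s 0 := by
      intro ζ hζ hc
      have h0 := nonneg_of_mem_distValues hn hs ((hmem _).2 ⟨ζ, hζ, hc, rfl⟩)
      rw [le_div_iff₀ hα]
      rw [sub_nonneg, div_le_iff₀ hA] at h0
      linarith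
    have hB : 0 < B := by
      have := hbound ζ₀ hζ₀ hcrit
      nlinarith [sq_nonneg (confMoment s f ζ₀)]
    obtain ⟨R, hR0, hR1, hR⟩ := exists_radius hn hs hf hB
    have hcritR : ∀ ζ : Eu n, ‖ζ‖ < 1 → (∀ e, critFun s f e ζ = 0) → ‖ζ‖ ≤ R := by
      intro ζ hζ hc
      refine hR ζ hζ ?_
      have := hbound ζ hζ hc
      nlinarith [sq_nonneg (confMoment s f ζ - 1)]
    -- The whole critical set, enclosed in a ball of radius R < 1 on which G and its derivatives are
    -- continuous.
    set S : Set (Eu n) := ⋂ e, Metric.closedBall 0 R ∩ critFun s f e ⁻¹' {0} with hS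
    have hSclosed : IsClosed S := isClosed_iInter fun e =>
      (continuousOn_critFun hR1 e).preimage_isClosed_of_isClosed Metric.isClosed_closedBall
        isClosed_singleton
    have hSsub : S ⊆ Metric.closedBall 0 R := fun ζ hζ => (Set.mem_iInter.1 hζ 0).1
    have hScompact : IsCompact S := (isCompact_closedBall (0 : Eu n) R).of_isClosed_subset hSclosed hSsub
    have hSmem : ∀ ζ : Eu n, ‖ζ‖ < 1 → (∀ e, critFun s f e ζ = 0) → ζ ∈ S := fun ζ hζ hc =>
      Set.mem_iInter.2 fun e => ⟨by simpa using hcritR ζ hζ hc, hc e⟩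
    have hvalc : ContinuousOn val S :=
      (continuousOn_const.sub ((continuousOn_const.mul
        ((continuousOn_confMoment hR1).pow 2)).div_const _)).mono hSsub
    obtain ⟨ζ₁, hζ₁, h1⟩ := hScompact.exists_isMinOn ⟨ζ₀, hSmem ζ₀ hζ₀ hcrit⟩ hvalc
    have hζ₁' : ‖ζ₁‖ < 1 := lt_of_le_of_lt (by simpa using hSsub hζ₁) hR1
    refine ⟨val ζ₁, (hmem _).2 ⟨ζ₁, hζ₁', fun e => (Set.mem_iInter.1 hζ₁ e).2, rfl⟩, fun t ht => ?_⟩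
    obtain ⟨ζ, hζ, hc, rfl⟩ := (hmem t).1 ht
    exact h1 (hSmem ζ hζ hc)

end decomposition

end ReverseSobolev

end

theorem mainTheorem4 (n : ℕ) (hn : 1 ≤ n) (s : ℝ)
    (hs : s - n / 2 ∈ Set.Ioo (0 : ℝ) 1 ∪ Set.Ioo (1 : ℝ) 2) :
    (∀ h ∈ ReverseSobolev.optimizers n s, ∀ ρ ∈ ReverseSobolev.tangentPerp n s h,
        ρ ≠ 0 → 0 < ReverseSobolev.aQuad n s ρ) ∧
    ∀ u ∈ ReverseSobolev.Hs n s, ReverseSobolev.IsPos u →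
      (∃ h ∈ ReverseSobolev.optimizers n s,
        ∃ ρ ∈ ReverseSobolev.tangentPerp n s h, u = ReverseSobolev.toL2 n h + ρ) ∧
      (ReverseSobolev.distValues n s u).Nonempty ∧
      BddBelow (ReverseSobolev.distValues n s u) ∧
      (u ∉ ReverseSobolev.toL2 n '' ReverseSobolev.optimizers n s →
        0 < ReverseSobolev.dist n s u) := by
  have hs' : ReverseSobolev.Admissible n s := hs
  refine ⟨fun h hh ρ hρ hρ0 => ReverseSobolev.aQuad_pos_of_mem_tangentPerp hn hs' hh hρ hρ0, ?_⟩
  rintro _ hu ⟨f, rfl, hf⟩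
  have hne := ReverseSobolev.distValues_nonempty hn hs' hu hf
  refine ⟨?_, hne, ⟨0, fun t ht => ReverseSobolev.nonneg_of_mem_distValues hn hs' ht⟩, fun hnot => ?_⟩
  · obtain ⟨_, h, hh, ρ, hρ, hsum, -⟩ := hne
    exact ⟨h, hh, ρ, hρ, hsum⟩
  -- Positivity of each value does not by itself make the infimum positive; attainment does.
  · obtain ⟨t, ht⟩ := ReverseSobolev.exists_isLeast_distValues hn hs' hu hf
    rw [ReverseSobolev.dist, ht.csInf_eq]
    exact ReverseSobolev.pos_of_mem_distValues hn hs' hnot ht.1
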